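/- Let $m\ge 2$, $N\ge 1$, and let $T_1,\dots,T_m$ be non-singular linear maps on $\mathbb{R}^N$ (Euclidean norm) with $\|T_i\|<1$. For a word $\mathbf i=(i_1,\dots,i_k)$ over $\{1,\dots,m\}$ put $T_{\mathbf i}=T_{i_1}\cdots T_{i_k}$ and let $C_{\mathbf i}$ be the cylinder of all infinite sequences in $I_\infty=\{1,\dots,m\}^{\mathbb N}$ that begin with $\mathbf i$; for $\mathbf i\in I_\infty$ write $\mathbf i|k$ for its first $k$ terms. For a non-singular linear map $T$ with singular values $\alpha_1\ge\dots\ge\alpha_N>0$ let $\phi^0(T)=1$, $\phi^s(T)=\alpha_1\cdots\alpha_{n-1}\alpha_n^{s-n+1}$ if $n-1<s\le n$ with $n\in\{1,\dots,N\}$, and $\phi^s(T)=(\alpha_1\cdots\alpha_N)^{s/N}$ if $s\ge N$. Let $\mu$ be a Gibbs measure on $I_\infty$, that is, a Borel probability measure for which there are a continuous $f:I_\infty\to\mathbb{R}$, a real number $P(f)$ and $a>0$ such that $$a^{-1}\le\frac{\mu(C_{\mathbf i|k})}{\exp\big(-kP(f)+\sum_{j=0}^{k-1}f(\sigma^j\mathbf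 i)\big)}\le a\qquad(\mathbf i\in I_\infty,\ k\ge 1),$$ where $\sigma$ is the shift. For $s\ge 0$ and $0\le q<1$ put $$P(s,q)=\lim_{k\to\infty}\frac1k\,\frac{\log\sum_{|\mathbf i|=k}\phi^s(T_{\mathbf i})^{1-q}\mu(C_{\mathbf i})^q}{q-1}.$$ Then these limits exist (in $\mathbb{R}$), for each $0\le q<1$ there is a unique $d_q>0$ with $P(d_q,q)=0$, the limit $\lim_{q\nearrow1}d_q$ exists in $\mathbb{R}$, and the following holds. Let $\mathbf w=(w_{\mathbf i})$ be any family of vectors in $\mathbb{R}^N$ indexed by the non-empty finite words such that, for some non-empty compact $B\subset\mathbb{R}^N$, $T_{i_k}(B)+w_{i_1,\dots,i_k}\subseteq B$ for all words $(i_1,\dots,i_k)$ with $k\ge1$. Let $$x^{\mathbf w}(\mathbf i)=w_{i_1}+T_{i_1}w_{i_1,i_2}+T_{i_1}T_{i_2}w_{i_1,i_2,i_3}+\cdots\qquad(\mathbf i\in I_\infty),$$ and let $\mu^{\mathbf w}(A)=\mu\{\mathbf i:x^{\mathbf w}(\mathbf i)\in A\}$ be the projection of $\mu$ to $\mathbb{R}^N$.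 Then, with $B(x,r)$ the closed ball, $$\limsup_{r\to0}\frac{\log\mu^{\mathbf w}(B(x,r))}{\log r}\le\min\Big\{\lim_{q\nearrow1}d_q,\,N\Big\}$$ for $\mu^{\mathbf w}$-almost all $x\in\mathbb{R}^N$. -/

import Mathlib

open MeasureTheory Filter Topology Set

namespace AlmostSelfAffine

noncomputable section

/-- `N`-dimensional Euclidean space. -/
abbrev E (N : ℕ) : Type := EuclideanSpace ℝ (Fin N)

/-- The code space of infinite sequences over an alphabet with `m` letters, with the product
topology and its Borel sigma-algebra. -/
abbrev Code (m : ℕ) : Type := ℕ → Fin m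

/-- The curtailment of an infinite sequence after `k` terms. -/
def curtail {m : ℕ} (i : Code m) (k : ℕ) : Fin k → Fin m := fun j => i j

/-- The cylinder of all infinite sequences starting with the finite word `u`. -/
def cyl {m k : ℕ} (u : Fin k → Fin m) : Set (Code m) := {i | curtail i k = u}

/-- The shift on code space. -/
def shift {m : ℕ} (i : Code m) : Code m := fun n => i (n + 1)

/-- Gibbs measures: Borel probability measures on code space that satisfy the two-sided Gibbs
estimate for a continuous potential `f`, a real number `P` (the pressure of `f`) and a constant
`a`. Shift invariance is not required. -/
def IsGibbs {m : ℕ} (μ : Measure (Code m)) : Prop :=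
  IsProbabilityMeasure μ ∧
    ∃ f : Code m → ℝ, Continuous f ∧ ∃ P a : ℝ, 0 < a ∧
      ∀ (i : Code m) (k : ℕ), 1 ≤ k →
        a⁻¹ ≤ μ.real (cyl (curtail i k)) /
            Real.exp (-(k : ℝ) * P + ∑ j ∈ Finset.range k, f (shift^[j] i)) ∧
          μ.real (cyl (curtail i k)) /
            Real.exp (-(k : ℝ) * P + ∑ j ∈ Finset.range k, f (shift^[j] i)) ≤ a

/-- The product `T_{u_1} T_{u_2} ⋯ T_{u_k}` of linear maps along the word `u`. -/
def wordMap {m N k : ℕ} (T : Fin m → E N →L[ℝ] E N) (u : Fin k → Fin m) : E N →L[ℝ] E N :=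
  (List.ofFn fun j => T (u j)).prod

/-- The singular value function `φ^s(A)`. Mathlib's singular values are decreasing and indexed from
`0`, so for `0 ≤ s < N` this is `α_1 ⋯ α_n α_{n+1}^{s-n}` with `n = ⌊s⌋`, which agrees with
`α_1 ⋯ α_{n-1} α_n^{s-n+1}` for `n - 1 < s ≤ n`; for `s ≥ N` it is `(α_1 ⋯ α_N)^{s/N}`. -/
def phi {N : ℕ} (s : ℝ) (A : E N →L[ℝ] E N) : ℝ :=
  if s < N then
    (∏ j ∈ Finset.range ⌊s⌋₊, (A : E N →ₗ[ℝ] E N).singularValues j) *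
      (A : E N →ₗ[ℝ] E N).singularValues ⌊s⌋₊ ^ (s - ⌊s⌋₊)
  else
    (∏ j ∈ Finset.range N, (A : E N →ₗ[ℝ] E N).singularValues j) ^ (s / N)

/-- The `k`-th term of the sequence whose limit is the pressure `P(s,q)`. -/
def pressureSeq {m N : ℕ} (T : Fin m → E N →L[ℝ] E N) (μ : Measure (Code m)) (s q : ℝ) (k : ℕ) :
    ℝ :=
  if q = 1 then
    1 / (k : ℝ) * ∑ u : Fin k → Fin m,
      μ.real (cyl u) * Real.log ((phi s (wordMap T u))⁻¹ * μ.real (cyl u))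
  else
    1 / (k : ℝ) * (Real.log (∑ u : Fin k → Fin m,
      phi s (wordMap T u) ^ (1 - q) * μ.real (cyl u) ^ q) / (q - 1))

/-- The pressure `P(s,q)`. -/
def pressure {m N : ℕ} (T : Fin m → E N →L[ℝ] E N) (μ : Measure (Code m)) (s q : ℝ) : ℝ :=
  limUnder atTop (pressureSeq T μ s q)

/-- The positive number `d_q` with `P(d_q, q) = 0`. -/
def dimZero {m N : ℕ} (T : Fin m → E N →L[ℝ] E N) (μ : Measure (Code m)) (q : ℝ) : ℝ :=
  Classical.epsilon fun d : ℝ => 0 < d ∧ pressure T μ d q = 0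

/-- A family of translation vectors indexed by the finite words. -/
abbrev Translations (m N : ℕ) : Type := (k : ℕ) → (Fin k → Fin m) → E N

/-- There is a non-empty compact set `B` with `T_{u_k}(B) + w_{u_1 … u_k} ⊆ B` for every non-empty
finite word `u_1 … u_k`. -/
def Admissible {m N : ℕ} (T : Fin m → E N →L[ℝ] E N) (w : Translations m N) : Prop :=
  ∃ B : Set (E N), B.Nonempty ∧ IsCompact B ∧
    ∀ (k : ℕ) (u : Fin (k + 1) → Fin m), ∀ x ∈ B, T (u (Fin.last k)) x + w (k + 1) u ∈ B

/-- The coding map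
`x^w(i) = w_{i_1} + T_{i_1} w_{i_1 i_2} + T_{i_1} T_{i_2} w_{i_1 i_2 i_3} + ⋯`. -/
def codeMap {m N : ℕ} (T : Fin m → E N →L[ℝ] E N) (w : Translations m N) (i : Code m) : E N :=
  ∑' k : ℕ, wordMap T (curtail i k) (w (k + 1) (curtail i (k + 1)))

/-- The projected measure `μ^w`, the image of `μ` under the coding map. -/
def projMeasure {m N : ℕ} (T : Fin m → E N →L[ℝ] E N) (w : Translations m N)
    (μ : Measure (Code m)) : Measure (E N) :=
  μ.map (codeMap T w)

/-- The upper local dimension `limsup_{r → 0} log ν(B(x,r)) / log r`, with closed balls, as an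
extended real number (it is `⊤` outside the support of `ν`). -/
def upperLocalDim {N : ℕ} (ν : Measure (E N)) (x : E N) : EReal :=
  limsup (fun r : ℝ => ENNReal.log (ν (Metric.closedBall x r)) / (Real.log r : EReal)) (𝓝[>] 0)

/-! The coding map is given by an absolutely convergent series and is continuous, so that the
projected measure is a genuine image measure. -/

theorem exists_bound {m N : ℕ} (T : Fin m → E N →L[ℝ] E N) (hT : ∀ i, ‖T i‖ < 1)
    (w : Translations m N) (hw : Admissible T w) :
    ∃ f : ℕ → ℝ, Summable f ∧ ∀ (k : ℕ) (i : Code m),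
      ‖wordMap T (curtail i k) (w (k + 1) (curtail i (k + 1)))‖ ≤ f k := by
  obtain ⟨B, ⟨x, hx⟩, hBc, hB⟩ := hw
  obtain ⟨R, hR⟩ := hBc.isBounded.exists_norm_le
  obtain ⟨ρ, hρ0, hρ1, hρ⟩ : ∃ ρ : ℝ, 0 ≤ ρ ∧ ρ < 1 ∧ ∀ i, ‖T i‖ ≤ ρ := by
    refine ⟨(Finset.univ.sup fun i => ‖T i‖₊ : NNReal), NNReal.coe_nonneg _, ?_, fun i => ?_⟩
    · have : (Finset.univ.sup fun i => ‖T i‖₊) < 1 :=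
        (Finset.sup_lt_iff (by simp)).2 fun i _ => hT i
      exact_mod_cast this
    · exact_mod_cast Finset.le_sup (f := fun i => ‖T i‖₊) (Finset.mem_univ i)
  have hw' : ∀ (k : ℕ) (u : Fin (k + 1) → Fin m), ‖w (k + 1) u‖ ≤ R + R := by
    intro k u
    have h1 := hR _ (hB k u x hx)
    have h2 : ‖T (u (Fin.last k)) x‖ ≤ R :=
      (((T _).le_opNorm x).trans (mul_le_of_le_one_left (norm_nonneg _) (hT _).le)).trans (hR x hx)
    calc ‖w (k + 1) u‖ = ‖(T (u (Fin.last k)) x + w (k + 1) u) - T (u (Fin.last k)) x‖ := by simp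
      _ ≤ R + R := (norm_sub_le _ _).trans (add_le_add h1 h2)
  have hword : ∀ (k : ℕ) (u : Fin k → Fin m), ‖wordMap T u‖ ≤ ρ ^ k := by
    intro k
    induction k with
    | zero =>
      intro u
      have h : ‖(1 : E N →L[ℝ] E N)‖ ≤ 1 := ContinuousLinearMap.norm_id_le
      simpa [wordMap] using h
    | succ k ih =>
      intro u
      have : wordMap T u = T (u 0) * wordMap T (fun j => u j.succ) := by
        simp [wordMap, List.ofFn_succ]
      rw [this, pow_succ']
      exact (norm_mul_le _ _).trans (mul_le_mul (hρ _) (ih _) (norm_nonneg _) hρ0)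
  refine ⟨fun k => ρ ^ k * (R + R), (summable_geometric_of_lt_one hρ0 hρ1).mul_right _, ?_⟩
  intro k i
  exact ((wordMap T _).le_opNorm _).trans
    (mul_le_mul (hword _ _) (hw' _ _) (norm_nonneg _) (pow_nonneg hρ0 _))

theorem summable_codeMap {m N : ℕ} (T : Fin m → E N →L[ℝ] E N) (hT : ∀ i, ‖T i‖ < 1)
    (w : Translations m N) (hw : Admissible T w) (i : Code m) :
    Summable fun k : ℕ => wordMap T (curtail i k) (w (k + 1) (curtail i (k + 1))) := by
  obtain ⟨f, hf, hb⟩ := exists_bound T hT w hw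
  exact Summable.of_norm_bounded hf fun k => hb k i

theorem continuous_codeMap {m N : ℕ} (T : Fin m → E N →L[ℝ] E N) (hT : ∀ i, ‖T i‖ < 1)
    (w : Translations m N) (hw : Admissible T w) : Continuous (codeMap T w) := by
  obtain ⟨f, hf, hb⟩ := exists_bound T hT w hw
  refine continuous_tsum (fun k => ?_) hf hb
  have hc : ∀ n, Continuous fun i : Code m => curtail i n := fun n =>
    continuous_pi fun j => continuous_apply _
  have h : Continuous fun p : (Fin k → Fin m) × (Fin (k + 1) → Fin m) =>
      wordMap T p.1 (w (k + 1) p.2) := continuous_of_discreteTopology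
  exact h.comp ((hc k).prodMk (hc (k + 1)))

end

end AlmostSelfAffine

/-! Fix `d` with `lim d_q < d < N` and some `q < 1` with `d_q < d`. Then `P(d, q) > 0`, and since `q
- 1 < 0` the sums of `φ^d(T_u)^(1-q) μ(C_u)^q` over words `u` of length `k` decay exponentially in
`k` (`exists_summable_wordSum`).

Let `a` be the singular value of `T_u` of index `⌊d⌋`, counted from `0`. The image of `C_u` lies in
a translate of an ellipsoid whose semi-axes are a constant times the singular values of `T_u`, and
at most a constant times `φ^d(T_u) a^(-d)` boxes of diameter at most `√N a` cover it. A point is bad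
if the ball of radius `√N a` about its image has mass below `a^d`. The bad points in one box have
mass at most `a^d`, so the bad part of `C_u` has mass `O(φ^d(T_u))`
(`exists_measure_cyl_small_ball_le`). It also has mass at most `μ(C_u)`, and the minimum of the two
bounds is at most their geometric mean with weights `1 - q` and `q`. By Borel-Cantelli almost every
sequence is bad for only finitely many `k`; successive radii have ratios bounded below, so the mass
bound passes to all small radii (`ae_upperLocalDim_projMeasure_le`). For `d > N` a cubic grid
replaces the boxes. The argument works for every admissible family of translations.

The pressure exists by Fekete's lemma: `φ^s` is submultiplicative because products of top singular
values are norms of exterior powers (`topProd_mul_le`), and `μ` is quasi-Bernoulli. The pressure is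
negative at `s = 0` and grows in `s` at a rate between two positive constants, hence has exactly one
zero. By Jensen it increases with `q` (`pressure_mono_exponent`), so `d_q` decreases and has a
limit. -/

namespace AlmostSelfAffine

/-! ### Singular values and exterior powers. -/

/-- The product of the `n` largest singular values. -/
noncomputable def topProd {N : ℕ} (A : E N →L[ℝ] E N) (n : ℕ) : ℝ :=
  ∏ j ∈ Finset.range n, (A : E N →ₗ[ℝ] E N).singularValues j

theorem topProd_nonneg {N : ℕ} (A : E N →L[ℝ] E N) (n : ℕ) : 0 ≤ topProd A n :=
  Finset.prod_nonneg fun j _ => (A : E N →ₗ[ℝ] E N).singularValues_nonneg j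

/-- An orthonormal eigenbasis of `A†A` works: `⟪A e_i, A e_j⟫ = ⟪e_i, A†A e_j⟫`, and the eigenvalues
are the squared singular values. -/
theorem exists_singular_basis {N : ℕ} (A : E N →L[ℝ] E N) :
    ∃ e : OrthonormalBasis (Fin N) ℝ (E N), ∀ i j, inner ℝ (A (e i)) (A (e j)) =
      if i = j then (A : E N →ₗ[ℝ] E N).singularValues i ^ 2 else 0 := by
  have hN : Module.finrank ℝ (E N) = N := by simp
  have hs := (A : E N →ₗ[ℝ] E N).isSymmetric_adjoint_comp_self
  refine ⟨hs.eigenvectorBasis hN, fun i j => ?_⟩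
  have h := hs.apply_eigenvectorBasis hN j
  have h2 : inner ℝ (A (hs.eigenvectorBasis hN i)) (A (hs.eigenvectorBasis hN j)) =
      inner ℝ (hs.eigenvectorBasis hN i)
        (((A : E N →ₗ[ℝ] E N).adjoint ∘ₗ (A : E N →ₗ[ℝ] E N)) (hs.eigenvectorBasis hN j)) := by
    rw [LinearMap.comp_apply, LinearMap.adjoint_inner_right]
    rfl
  rw [h2, h, inner_smul_right, orthonormal_iff_ite.1 (hs.eigenvectorBasis hN).orthonormal,
    LinearMap.sq_singularValues_fin _ hN]
  split_ifs with hij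
  · subst hij; simp
  · simp

theorem singularValues_le_norm {N : ℕ} (A : E N →L[ℝ] E N) (j : ℕ) :
    (A : E N →ₗ[ℝ] E N).singularValues j ≤ ‖A‖ := by
  rcases lt_or_ge j N with hj | hj
  · obtain ⟨e, he⟩ := exists_singular_basis A
    have h := he ⟨j, hj⟩ ⟨j, hj⟩
    rw [real_inner_self_eq_norm_sq, if_pos rfl] at h
    have h2 := A.le_opNorm (e ⟨j, hj⟩)
    rw [e.norm_eq_one, mul_one] at h2
    rwa [(sq_eq_sq₀ (norm_nonneg _) (LinearMap.singularValues_nonneg _ _)).1 h] at h2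
  · rw [LinearMap.singularValues_of_finrank_le _ (by simpa using hj)]
    exact norm_nonneg A

theorem le_singularValues {N : ℕ} {A : E N →L[ℝ] E N} {c : ℝ} (hA : ∀ x, c * ‖x‖ ≤ ‖A x‖) {j : ℕ}
    (hj : j < N) : c ≤ (A : E N →ₗ[ℝ] E N).singularValues j := by
  obtain ⟨e, he⟩ := exists_singular_basis A
  have h := he ⟨j, hj⟩ ⟨j, hj⟩
  rw [real_inner_self_eq_norm_sq, if_pos rfl] at h
  have h2 := hA (e ⟨j, hj⟩)
  rw [e.norm_eq_one, mul_one] at h2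
  rwa [(sq_eq_sq₀ (norm_nonneg _) (LinearMap.singularValues_nonneg _ _)).1 h] at h2

theorem singularValues_pos {N : ℕ} {A : E N →L[ℝ] E N} (hA : Function.Injective A) {j : ℕ}
    (hj : j < N) : 0 < (A : E N →ₗ[ℝ] E N).singularValues j :=
  (A : E N →ₗ[ℝ] E N).injective_iff_forall_lt_finrank_singularValues_pos.1 hA j (by simpa using hj)

-- In a singular basis the vectors `A e_i` are orthogonal, so the induced map sends the wedge basis
-- to orthogonal vectors whose lengths are products of `n` distinct singular values. The largest
-- such product is `topProd A n`, which is therefore the operator norm of the `n`-th exterior power.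
open exteriorPower Set.powersetCard in
theorem exists_norm_map_exteriorPower {N : ℕ} (A : E N →L[ℝ] E N) {n : ℕ} (hn : n ≤ N) :
    (∀ x : ⋀[ℝ]^n (E N), ‖exteriorPower.map n (A : E N →ₗ[ℝ] E N) x‖ ≤ topProd A n * ‖x‖) ∧
      ∃ x : ⋀[ℝ]^n (E N), ‖x‖ = 1 ∧
        ‖exteriorPower.map n (A : E N →ₗ[ℝ] E N) x‖ = topProd A n := by
  obtain ⟨e, he⟩ := exists_singular_basis A
  set b := e.exteriorPower n with hb
  set α := fun j => (A : E N →ₗ[ℝ] E N).singularValues j with hα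
  set M := exteriorPower.map n (A : E N →ₗ[ℝ] E N) with hM
  have hbs : ∀ s, b s = ιMulti ℝ n (e ∘ ofFinEmbEquiv.symm s) := by
    intro s
    rw [← OrthonormalBasis.coe_toBasis, hb, OrthonormalBasis.toBasis_exteriorPower, basis_apply,
      OrthonormalBasis.coe_toBasis]
    rfl
  have hMb : ∀ s, M (b s) = ιMulti ℝ n fun i => A (e (ofFinEmbEquiv.symm s i)) := by
    intro s
    rw [hbs, hM, map_apply_ιMulti]
    rfl
  have hin : ∀ s t, inner ℝ (M (b s)) (M (b t)) =
      if s = t then (∏ i, α (ofFinEmbEquiv.symm s i)) ^ 2 else 0 := by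
    intro s t
    rw [hMb, hMb, inner_ιMulti_ιMulti]
    split_ifs with hst
    · subst hst
      have : (Matrix.of fun i j => inner ℝ (A (e (ofFinEmbEquiv.symm s j)))
          (A (e (ofFinEmbEquiv.symm s i)))) =
          Matrix.diagonal fun i => α (ofFinEmbEquiv.symm s i) ^ 2 := by
        ext i j
        rw [Matrix.of_apply, he, Matrix.diagonal_apply]
        by_cases hij : i = j
        · subst hij; simp [hα]
        · rw [if_neg hij, if_neg fun h => hij ((ofFinEmbEquiv.symm s).injective h).symm]
      rw [this, Matrix.det_diagonal, Finset.prod_pow]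
    · obtain ⟨x, hxt, hxs⟩ := (exists_mem_notMem_iff_ne t s).mp (.symm hst)
      simp only [Set.mem_range, not_exists,
        ← Set.powersetCard.mem_range_ofFinEmbEquiv_symm_iff_mem] at hxs hxt
      obtain ⟨i, rfl⟩ := hxt
      refine Matrix.det_eq_zero_of_row_eq_zero i fun j => ?_
      rw [Matrix.of_apply, he, if_neg (hxs j)]
  have hα0 : ∀ j, 0 ≤ α j := fun j => LinearMap.singularValues_nonneg _ j
  have htop : topProd A n = ∏ i : Fin n, α i := by
    rw [topProd, ← Fin.prod_univ_eq_prod_range]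
  have hle : ∀ s : Set.powersetCard (Fin N) n, ∏ i, α (ofFinEmbEquiv.symm s i) ≤ topProd A n := by
    intro s
    rw [htop]
    refine Finset.prod_le_prod (fun i _ => hα0 _) fun i _ => ?_
    refine LinearMap.singularValues_antitone _ ?_
    have hmono : StrictMono fun i : Fin n => ((ofFinEmbEquiv.symm s i : Fin N) : ℕ) :=
      fun i j hij => (ofFinEmbEquiv.symm s).strictMono hij
    -- The `k`-th element of an increasing enumeration is at least `k`, so its singular value is at
    -- most the `k`-th one.
    have key : ∀ k (hk : k < n), k ≤ ((ofFinEmbEquiv.symm s ⟨k, hk⟩ : Fin N) : ℕ) := by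
      intro k
      induction k with
      | zero => intro _; exact Nat.zero_le _
      | succ k ih =>
        intro hk
        exact (Nat.succ_le_succ (ih (by omega))).trans
          (hmono (a := ⟨k, by omega⟩) (b := ⟨k + 1, hk⟩) (Nat.lt_succ_self k))
    exact key i i.2
  refine ⟨fun x => ?_, ?_⟩
  · have hx : M x = ∑ s, b.repr x s • M (b s) := by
      conv_lhs => rw [← b.sum_repr x]
      simp
    have hsm : ∀ (c d : ℝ) (y z : ⋀[ℝ]^n (E N)), inner ℝ (c • y) (d • z) = c * d * inner ℝ y z := by
      intro c d y z
      exact (real_inner_smul_left y (d • z) c).trans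
        (by rw [show inner ℝ y (d • z) = d * inner ℝ y z from real_inner_smul_right y z d, mul_assoc])
    have h1 : ‖M x‖ ^ 2 = ∑ s, b.repr x s ^ 2 * (∏ i, α (ofFinEmbEquiv.symm s i)) ^ 2 := by
      rw [← real_inner_self_eq_norm_sq, hx, sum_inner]
      refine Finset.sum_congr rfl fun s _ => ?_
      rw [inner_sum, Finset.sum_eq_single s]
      · rw [hsm, hin, if_pos rfl, sq (b.repr x s)]
      · intro t _ hts
        rw [hsm, hin, if_neg hts.symm, mul_zero]
      · simp
    have h2 : ‖x‖ ^ 2 = ∑ s, b.repr x s ^ 2 := by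
      rw [← b.repr.norm_map x, EuclideanSpace.real_norm_sq_eq]
    refine le_of_sq_le_sq ?_ (mul_nonneg (topProd_nonneg A n) (norm_nonneg x))
    rw [h1, mul_pow, h2, Finset.mul_sum]
    refine Finset.sum_le_sum fun s _ => ?_
    rw [mul_comm]
    gcongr
    · exact Finset.prod_nonneg fun i _ => hα0 _
    · exact hle s
  · refine ⟨b (ofFinEmbEquiv (Fin.castLEOrderEmb hn)), b.norm_eq_one _, ?_⟩
    have h := hin (ofFinEmbEquiv (Fin.castLEOrderEmb hn)) (ofFinEmbEquiv (Fin.castLEOrderEmb hn))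
    rw [if_pos rfl, real_inner_self_eq_norm_sq, sq_eq_sq₀ (norm_nonneg _)
      (Finset.prod_nonneg fun i _ => hα0 _)] at h
    rw [h, htop]
    simp

/-- Exterior powers are functorial and operator norms are submultiplicative. For `n > N` every
product contains a vanishing singular value. -/
theorem topProd_mul_le {N : ℕ} (A B : E N →L[ℝ] E N) (n : ℕ) :
    topProd (A * B) n ≤ topProd A n * topProd B n := by
  rcases le_or_gt n N with hn | hn
  · obtain ⟨x, hx1, hx⟩ := (exists_norm_map_exteriorPower (A * B) hn).2
    have hc : ((A * B : E N →L[ℝ] E N) : E N →ₗ[ℝ] E N) =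
      (A : E N →ₗ[ℝ] E N) ∘ₗ (B : E N →ₗ[ℝ] E N) := rfl
    rw [← hx, hc, exteriorPower.map_comp, LinearMap.comp_apply]
    refine ((exists_norm_map_exteriorPower A hn).1 _).trans ?_
    refine mul_le_mul_of_nonneg_left ?_ (topProd_nonneg A n)
    simpa [hx1] using (exists_norm_map_exteriorPower B hn).1 x
  · have h : ∀ C : E N →L[ℝ] E N, topProd C n = 0 := fun C =>
      Finset.prod_eq_zero (i := N) (by simpa using hn)
        (LinearMap.singularValues_of_finrank_le _ (by simp))
    simp [h]

theorem topProd_pos {N : ℕ} {A : E N →L[ℝ] E N} (hA : Function.Injective A) {n : ℕ} (hn : n ≤ N) :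
    0 < topProd A n :=
  Finset.prod_pos fun _ hj => singularValues_pos hA ((Finset.mem_range.1 hj).trans_le hn)

theorem topProd_succ {N : ℕ} (A : E N →L[ℝ] E N) (n : ℕ) :
    topProd A (n + 1) = topProd A n * (A : E N →ₗ[ℝ] E N).singularValues n :=
  Finset.prod_range_succ _ n

/-! ### The singular value function. -/

theorem phi_of_lt {N : ℕ} {s : ℝ} (hs : s < N) (A : E N →L[ℝ] E N) :
    phi s A = topProd A ⌊s⌋₊ * (A : E N →ₗ[ℝ] E N).singularValues ⌊s⌋₊ ^ (s - ⌊s⌋₊) :=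
  if_pos hs

theorem phi_of_ge {N : ℕ} {s : ℝ} (hs : (N : ℝ) ≤ s) (A : E N →L[ℝ] E N) :
    phi s A = topProd A N ^ (s / N) :=
  if_neg hs.not_gt

theorem floor_lt_of_lt {N : ℕ} (hN : 1 ≤ N) {s : ℝ} (hs : s < N) : ⌊s⌋₊ < N :=
  (Nat.floor_lt' (by omega)).2 hs

/-- A weighted geometric mean of two consecutive `topProd`s inherits their submultiplicativity. -/
theorem phi_eq_interpolation {N : ℕ} {s : ℝ} (hN : 1 ≤ N) (hs : s < N) {A : E N →L[ℝ] E N}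
    (hA : Function.Injective A) :
    phi s A = topProd A ⌊s⌋₊ ^ (1 - (s - ⌊s⌋₊)) * topProd A (⌊s⌋₊ + 1) ^ (s - ⌊s⌋₊) := by
  have hn := floor_lt_of_lt hN hs
  have h1 := topProd_pos hA hn.le
  rw [phi_of_lt hs, topProd_succ, Real.mul_rpow h1.le (LinearMap.singularValues_nonneg _ _),
    ← mul_assoc, ← Real.rpow_add h1]
  simp

theorem phi_pos {N : ℕ} (hN : 1 ≤ N) (s : ℝ) {A : E N →L[ℝ] E N} (hA : Function.Injective A) :
    0 < phi s A := by
  rcases lt_or_ge s N with hs | hs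
  · rw [phi_of_lt hs]
    have hn := floor_lt_of_lt hN hs
    exact mul_pos (topProd_pos hA hn.le) (Real.rpow_pos_of_pos (singularValues_pos hA hn) _)
  · rw [phi_of_ge hs]
    exact Real.rpow_pos_of_pos (topProd_pos hA le_rfl) _

/-- The singular value function is submultiplicative. -/
theorem phi_mul_le {N : ℕ} (hN : 1 ≤ N) {s : ℝ} (hs : 0 ≤ s) {A B : E N →L[ℝ] E N}
    (hA : Function.Injective A) (hB : Function.Injective B) :
    phi s (A * B) ≤ phi s A * phi s B := by
  have hAB : Function.Injective (A * B) := hA.comp hB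
  rcases lt_or_ge s N with hsN | hsN
  · have hn := floor_lt_of_lt hN hsN
    have ht0 : 0 ≤ s - ⌊s⌋₊ := sub_nonneg.2 (Nat.floor_le hs)
    have ht1 : 0 ≤ 1 - (s - ⌊s⌋₊) := by linarith [Nat.lt_floor_add_one s]
    rw [phi_eq_interpolation hN hsN hA, phi_eq_interpolation hN hsN hB,
      phi_eq_interpolation hN hsN hAB, mul_mul_mul_comm,
      ← Real.mul_rpow (topProd_nonneg A _) (topProd_nonneg B _),
      ← Real.mul_rpow (topProd_nonneg A _) (topProd_nonneg B _)]
    exact mul_le_mul (Real.rpow_le_rpow (topProd_nonneg _ _) (topProd_mul_le A B _) ht1)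
      (Real.rpow_le_rpow (topProd_nonneg _ _) (topProd_mul_le A B _) ht0)
      (Real.rpow_nonneg (topProd_nonneg _ _) _)
      (Real.rpow_nonneg (mul_nonneg (topProd_nonneg A _) (topProd_nonneg B _)) _)
  · rw [phi_of_ge hsN, phi_of_ge hsN, phi_of_ge hsN,
      ← Real.mul_rpow (topProd_nonneg A _) (topProd_nonneg B _)]
    exact Real.rpow_le_rpow (topProd_nonneg _ _) (topProd_mul_le A B _) (by positivity)

/-- The exponent of the `j`-th singular value in `φ^s`. -/
noncomputable def phiWeight (N : ℕ) (s : ℝ) (j : ℕ) : ℝ :=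
  if s < N then min 1 (max 0 (s - j)) else s / N

theorem phiWeight_mono {N : ℕ} (hN : 1 ≤ N) {s t : ℝ} (hst : s ≤ t) (j : ℕ) :
    phiWeight N s j ≤ phiWeight N t j := by
  have hN' : (0 : ℝ) < N := by exact_mod_cast hN
  unfold phiWeight
  split_ifs with h1 h2 h2
  · gcongr
  · exact (min_le_left _ _).trans ((one_le_div hN').2 (not_lt.1 h2))
  · exact absurd (hst.trans_lt h2) h1
  · gcongr

theorem phiWeight_of_lt_floor {N : ℕ} {s : ℝ} (hsN : s < N) {j : ℕ} (hj : j < ⌊s⌋₊) :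
    phiWeight N s j = 1 := by
  have h0 : 0 ≤ s := by
    by_contra h
    rw [Nat.floor_of_nonpos (not_le.1 h).le] at hj
    omega
  have h1 : ((j + 1 : ℕ) : ℝ) ≤ s := (Nat.cast_le.2 hj).trans (Nat.floor_le h0)
  push_cast at h1
  rw [phiWeight, if_pos hsN, min_eq_left]
  exact le_max_of_le_right (by linarith)

theorem phiWeight_floor {N : ℕ} {s : ℝ} (hs : 0 ≤ s) (hsN : s < N) :
    phiWeight N s ⌊s⌋₊ = s - ⌊s⌋₊ := by
  have h1 := Nat.floor_le hs
  have h2 := Nat.lt_floor_add_one s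
  rw [phiWeight, if_pos hsN, max_eq_right (by linarith), min_eq_right (by linarith)]

theorem phiWeight_of_floor_lt {N : ℕ} {s : ℝ} (hsN : s < N) {j : ℕ} (hj : ⌊s⌋₊ < j) :
    phiWeight N s j = 0 := by
  have h := (Nat.floor_lt' (by omega)).1 hj
  rw [phiWeight, if_pos hsN, max_eq_left (by linarith), min_eq_right zero_le_one]

theorem sum_phiWeight {N : ℕ} (hN : 1 ≤ N) {s : ℝ} (hs : 0 ≤ s) :
    ∑ j ∈ Finset.range N, phiWeight N s j = s := by
  rcases lt_or_ge s N with hsN | hsN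
  · have hn := floor_lt_of_lt hN hsN
    have hsub : Finset.range (⌊s⌋₊ + 1) ⊆ Finset.range N := Finset.range_mono hn
    rw [← Finset.sum_subset hsub fun j _ hj =>
      phiWeight_of_floor_lt hsN (by simpa using hj), Finset.sum_range_succ,
      phiWeight_floor hs hsN, Finset.sum_congr rfl fun j hj =>
      phiWeight_of_lt_floor hsN (Finset.mem_range.1 hj)]
    simp
  · have hN' : (N : ℝ) ≠ 0 := by positivity
    simp only [phiWeight, if_neg hsN.not_gt, Finset.sum_const, Finset.card_range, nsmul_eq_mul]
    field_simp

theorem phi_eq_prod {N : ℕ} (hN : 1 ≤ N) {s : ℝ} (hs : 0 ≤ s) (A : E N →L[ℝ] E N) :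
    phi s A = ∏ j ∈ Finset.range N, (A : E N →ₗ[ℝ] E N).singularValues j ^ phiWeight N s j := by
  rcases lt_or_ge s N with hsN | hsN
  · have hn := floor_lt_of_lt hN hsN
    have hsub : Finset.range (⌊s⌋₊ + 1) ⊆ Finset.range N := Finset.range_mono hn
    rw [← Finset.prod_subset hsub fun j _ hj => by
      rw [phiWeight_of_floor_lt hsN (by simpa using hj), Real.rpow_zero], Finset.prod_range_succ,
      phiWeight_floor hs hsN, phi_of_lt hsN, topProd]
    congr 1
    refine Finset.prod_congr rfl fun j hj => ?_
    rw [phiWeight_of_lt_floor hsN (Finset.mem_range.1 hj), Real.rpow_one]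
  · rw [phi_of_ge hsN, topProd, ← Real.finsetProd_rpow _ _
      fun j _ => LinearMap.singularValues_nonneg _ j]
    simp [phiWeight, hsN.not_gt]

theorem phi_eq_phi_mul {N : ℕ} (hN : 1 ≤ N) {s t : ℝ} (hs : 0 ≤ s) (hst : s ≤ t)
    {A : E N →L[ℝ] E N} (hA : Function.Injective A) :
    phi t A = phi s A * ∏ j ∈ Finset.range N,
      (A : E N →ₗ[ℝ] E N).singularValues j ^ (phiWeight N t j - phiWeight N s j) := by
  rw [phi_eq_prod hN hs, phi_eq_prod hN (hs.trans hst), ← Finset.prod_mul_distrib]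
  refine Finset.prod_congr rfl fun j hj => ?_
  rw [← Real.rpow_add (singularValues_pos hA (Finset.mem_range.1 hj))]
  simp

/-- Each exponent `phiWeight` is nondecreasing in the parameter and the exponents sum to it, so
bounding every singular value by `C` costs exactly `C ^ (t - s)`. -/
theorem phi_le_mul_rpow {N : ℕ} (hN : 1 ≤ N) {s t : ℝ} (hs : 0 ≤ s) (hst : s ≤ t)
    {A : E N →L[ℝ] E N} (hA : Function.Injective A) {C : ℝ} (hC : 0 < C) (hAC : ‖A‖ ≤ C) :
    phi t A ≤ phi s A * C ^ (t - s) := by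
  rw [phi_eq_phi_mul hN hs hst hA]
  refine mul_le_mul_of_nonneg_left ?_ (phi_pos hN s hA).le
  calc _ ≤ ∏ j ∈ Finset.range N, C ^ (phiWeight N t j - phiWeight N s j) :=
        Finset.prod_le_prod
          (fun j _ => Real.rpow_nonneg (LinearMap.singularValues_nonneg _ j) _)
          fun j _ => Real.rpow_le_rpow (LinearMap.singularValues_nonneg _ j)
            ((singularValues_le_norm A j).trans hAC) (sub_nonneg.2 (phiWeight_mono hN hst j))
    _ = C ^ (t - s) := by
        rw [← Real.rpow_sum_of_pos hC, Finset.sum_sub_distrib, sum_phiWeight hN hs,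
          sum_phiWeight hN (hs.trans hst)]

theorem mul_rpow_le_phi {N : ℕ} (hN : 1 ≤ N) {s t : ℝ} (hs : 0 ≤ s) (hst : s ≤ t)
    {A : E N →L[ℝ] E N} (hA : Function.Injective A) {c : ℝ} (hc : 0 < c)
    (hAc : ∀ x, c * ‖x‖ ≤ ‖A x‖) : phi s A * c ^ (t - s) ≤ phi t A := by
  rw [phi_eq_phi_mul hN hs hst hA]
  refine mul_le_mul_of_nonneg_left ?_ (phi_pos hN s hA).le
  calc c ^ (t - s) = ∏ j ∈ Finset.range N, c ^ (phiWeight N t j - phiWeight N s j) := by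
        rw [← Real.rpow_sum_of_pos hc, Finset.sum_sub_distrib, sum_phiWeight hN hs,
          sum_phiWeight hN (hs.trans hst)]
    _ ≤ _ := Finset.prod_le_prod (fun j _ => Real.rpow_nonneg hc.le _)
          fun j hj => Real.rpow_le_rpow hc.le
            (le_singularValues hAc (Finset.mem_range.1 hj)) (sub_nonneg.2 (phiWeight_mono hN hst j))

theorem phi_zero {N : ℕ} (hN : 1 ≤ N) (A : E N →L[ℝ] E N) : phi 0 A = 1 := by
  rw [phi_of_lt (by exact_mod_cast hN)]
  simp [topProd]

/-- Composition on the right with a fixed injective map does not decrease a singular value by more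
than a constant factor. -/
theorem exists_mul_singularValues_le {N : ℕ} {B : E N →L[ℝ] E N} (hB : Function.Injective B)
    {n : ℕ} (hn : n < N) :
    ∃ κ : ℝ, 0 < κ ∧ ∀ A : E N →L[ℝ] E N, Function.Injective A →
      κ * (A : E N →ₗ[ℝ] E N).singularValues n ≤
        ((A * B : E N →L[ℝ] E N) : E N →ₗ[ℝ] E N).singularValues n := by
  let e : E N ≃ₗ[ℝ] E N := LinearEquiv.ofInjectiveEndo (B : E N →ₗ[ℝ] E N) hB
  let D : E N →L[ℝ] E N := e.toContinuousLinearEquiv.symm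
  have hBD : B * D = 1 := by
    ext1 x
    exact e.apply_symm_apply x
  have hD : Function.Injective D := e.toContinuousLinearEquiv.symm.injective
  have hBn := topProd_pos hB hn.le
  have hDn := topProd_pos hD (Nat.succ_le_of_lt hn)
  -- The singular value of index `n` is the quotient of the `topProd`s of orders `n + 1` and `n`.
  -- For `A * B` the numerator is bounded below through `A = (A * B) * D`, the denominator above by
  -- submultiplicativity.
  refine ⟨(topProd D (n + 1) * topProd B n)⁻¹, by positivity, fun A hA => ?_⟩
  have hAB : Function.Injective (A * B) := hA.comp hB
  have h1 : topProd A (n + 1) ≤ topProd (A * B) (n + 1) * topProd D (n + 1) := by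
    have h := topProd_mul_le (A * B) D (n + 1)
    rwa [mul_assoc, hBD, mul_one] at h
  have h2 := topProd_mul_le A B n
  have hAn := topProd_pos hA hn.le
  rw [topProd_succ A, topProd_succ (A * B)] at h1
  set a := (A : E N →ₗ[ℝ] E N).singularValues n
  have hb : 0 ≤ ((A * B : E N →L[ℝ] E N) : E N →ₗ[ℝ] E N).singularValues n :=
    LinearMap.singularValues_nonneg _ _
  set b := ((A * B : E N →L[ℝ] E N) : E N →ₗ[ℝ] E N).singularValues n
  rw [inv_mul_le_iff₀ (by positivity)]
  have h3 : topProd A n * a ≤ topProd A n * (topProd D (n + 1) * topProd B n * b) :=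
    calc _ ≤ _ := h1
      _ ≤ (topProd A n * topProd B n * b) * topProd D (n + 1) := by gcongr
      _ = _ := by ring
  exact le_of_mul_le_mul_left h3 hAn

/-! ### Products along words. -/

theorem wordMap_append {m N k l : ℕ} (T : Fin m → E N →L[ℝ] E N) (u : Fin k → Fin m)
    (v : Fin l → Fin m) : wordMap T (Fin.append u v) = wordMap T u * wordMap T v := by
  have h : (fun j => T (Fin.append u v j)) = Fin.append (fun j => T (u j)) (fun j => T (v j)) := by
    funext j
    refine Fin.addCases (fun i => ?_) (fun i => ?_) j <;> simp
  rw [wordMap, h, List.ofFn_fin_append, List.prod_append, wordMap, wordMap]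

theorem wordMap_zero {m N : ℕ} (T : Fin m → E N →L[ℝ] E N) (u : Fin 0 → Fin m) :
    wordMap T u = 1 := by
  simp [wordMap]

theorem wordMap_single {m N : ℕ} (T : Fin m → E N →L[ℝ] E N) (u : Fin 1 → Fin m) :
    wordMap T u = T (u 0) := by
  simp [wordMap]

/-- Induction on words by adding letters at the end. -/
theorem word_induction {m : ℕ} {p : ∀ k, (Fin k → Fin m) → Prop} (h0 : ∀ u, p 0 u)
    (h1 : ∀ k (u : Fin k → Fin m) (v : Fin 1 → Fin m), p k u → p (k + 1) (Fin.append u v)) :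
    ∀ k u, p k u := by
  intro k
  induction k with
  | zero => exact h0
  | succ k ih =>
    intro u
    rw [← Fin.append_castAdd_natAdd (m := k) (n := 1) (f := u)]
    exact h1 _ _ _ (ih _)

theorem wordMap_injective {m N : ℕ} {T : Fin m → E N →L[ℝ] E N}
    (hT : ∀ i, Function.Injective (T i)) (k : ℕ) (u : Fin k → Fin m) :
    Function.Injective (wordMap T u) := by
  induction k, u using word_induction with
  | h0 u => rw [wordMap_zero]; exact fun _ _ h => h
  | h1 k u v ih =>
    rw [wordMap_append, wordMap_single]
    exact ih.comp (hT _)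

theorem norm_wordMap_le {m N : ℕ} {T : Fin m → E N →L[ℝ] E N} {ρ : ℝ} (hρ0 : 0 ≤ ρ)
    (hT : ∀ i, ‖T i‖ ≤ ρ) (k : ℕ) (u : Fin k → Fin m) : ‖wordMap T u‖ ≤ ρ ^ k := by
  induction k, u using word_induction with
  | h0 u =>
    rw [wordMap_zero, pow_zero]
    exact ContinuousLinearMap.norm_id_le
  | h1 k u v ih =>
    rw [wordMap_append, wordMap_single, pow_succ]
    exact (norm_mul_le _ _).trans (mul_le_mul ih (hT _) (norm_nonneg _) (pow_nonneg hρ0 _))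

theorem le_norm_wordMap {m N : ℕ} {T : Fin m → E N →L[ℝ] E N} {c : ℝ} (hc : 0 ≤ c)
    (hT : ∀ i x, c * ‖x‖ ≤ ‖T i x‖) (k : ℕ) (u : Fin k → Fin m) (x : E N) :
    c ^ k * ‖x‖ ≤ ‖wordMap T u x‖ := by
  induction k, u using word_induction generalizing x with
  | h0 u => simp [wordMap_zero]
  | h1 k u v ih =>
    rw [wordMap_append, wordMap_single, mul_apply_eq_comp, pow_succ, mul_assoc]
    exact (mul_le_mul_of_nonneg_left (hT _ x) (pow_nonneg hc k)).trans (ih _)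

theorem exists_norm_le_lt_one {m N : ℕ} {T : Fin m → E N →L[ℝ] E N} (hT : ∀ i, ‖T i‖ < 1) :
    ∃ ρ : ℝ, 0 < ρ ∧ ρ < 1 ∧ ∀ i, ‖T i‖ ≤ ρ := by
  have h1 : (Finset.univ.sup fun i => ‖T i‖₊) < 1 :=
    (Finset.sup_lt_iff (by simp)).2 fun i _ => hT i
  refine ⟨max (1 / 2) (Finset.univ.sup fun i => ‖T i‖₊ : NNReal), by positivity,
    max_lt (by norm_num) (by exact_mod_cast h1), fun i => le_max_of_le_right ?_⟩
  exact_mod_cast Finset.le_sup (f := fun i => ‖T i‖₊) (Finset.mem_univ i)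

theorem exists_pos_lower_bound {m N : ℕ} {T : Fin m → E N →L[ℝ] E N}
    (hT : ∀ i, Function.Injective (T i)) :
    ∃ c : ℝ, 0 < c ∧ c < 1 ∧ ∀ i x, c * ‖x‖ ≤ ‖T i x‖ := by
  have h : ∀ i, ∃ c : ℝ, 0 < c ∧ ∀ x, c * ‖x‖ ≤ ‖T i x‖ := by
    intro i
    obtain ⟨K, hK, hKT⟩ := (T i : E N →ₗ[ℝ] E N).exists_antilipschitzWith
      (LinearMap.ker_eq_bot.2 (hT i))
    refine ⟨(K : ℝ)⁻¹, by positivity, fun x => ?_⟩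
    have hx := hKT.le_mul_dist x 0
    rw [inv_mul_le_iff₀ (by positivity)]
    simpa using hx
  choose c hc hcT using h
  obtain ⟨b, hb, hbc⟩ : ∃ b : ℝ, 0 < b ∧ ∀ i, b ≤ c i := by
    rcases isEmpty_or_nonempty (Fin m) with he | he
    · exact ⟨1, one_pos, fun i => he.elim i⟩
    · obtain ⟨i, hi⟩ := Finite.exists_min c
      exact ⟨c i, hc i, hi⟩
  refine ⟨min b (1 / 2), by positivity, (min_le_right _ _).trans_lt (by norm_num), fun i x => ?_⟩
  exact (mul_le_mul_of_nonneg_right ((min_le_left _ _).trans (hbc i)) (norm_nonneg x)).trans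
    (hcT i x)

/-! ### Cylinders and Gibbs measures. -/

theorem shift_iterate_apply {m : ℕ} (i : Code m) (k n : ℕ) : shift^[k] i n = i (n + k) := by
  induction k generalizing i with
  | zero => rfl
  | succ k ih =>
    rw [Function.iterate_succ_apply, ih, shift]
    congr 1

theorem curtail_add {m : ℕ} (i : Code m) (k l : ℕ) :
    curtail i (k + l) = Fin.append (curtail i k) (curtail (shift^[k] i) l) := by
  funext j
  refine Fin.addCases (fun i => ?_) (fun i => ?_) j
  · simp [curtail]
  · simp [curtail, shift_iterate_apply, add_comm]

theorem exists_mem_cyl {m k : ℕ} (hm : 0 < m) (u : Fin k → Fin m) : ∃ i : Code m, curtail i k = u :=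
  ⟨fun n => if h : n < k then u ⟨n, h⟩ else ⟨0, hm⟩, by funext j; simp [curtail]⟩

theorem append_inj {m k l : ℕ} {u u' : Fin k → Fin m} {v v' : Fin l → Fin m}
    (h : Fin.append u v = Fin.append u' v') : u = u' ∧ v = v' := by
  constructor
  · funext j
    simpa using congrFun h (Fin.castAdd l j)
  · funext j
    simpa using congrFun h (Fin.natAdd k j)

theorem mem_cyl_append {m k l : ℕ} {i : Code m} {u : Fin k → Fin m} {v : Fin l → Fin m} :
    i ∈ cyl (Fin.append u v) ↔ i ∈ cyl u ∧ shift^[k] i ∈ cyl v := by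
  change curtail i (k + l) = _ ↔ curtail i k = u ∧ curtail (shift^[k] i) l = v
  rw [curtail_add]
  exact ⟨append_inj, fun h => by rw [h.1, h.2]⟩

theorem measurable_curtail {m : ℕ} (k : ℕ) : Measurable fun i : Code m => curtail i k :=
  measurable_pi_lambda _ fun _ => measurable_pi_apply _

theorem measurableSet_cyl {m k : ℕ} (u : Fin k → Fin m) : MeasurableSet (cyl u) :=
  measurable_curtail k (measurableSet_singleton u)

theorem sum_measure_cyl {m : ℕ} (μ : Measure (Code m)) [IsProbabilityMeasure μ] (k : ℕ) :
    ∑ u : Fin k → Fin m, μ.real (cyl u) = 1 := by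
  have h := measureReal_biUnion_finset (μ := μ) (s := Finset.univ)
    (f := fun u : Fin k → Fin m => cyl u)
    (fun u _ v _ huv => Set.disjoint_left.2 fun i hi hi' => huv (hi.symm.trans hi'))
    (fun u _ => measurableSet_cyl u)
  rw [← h]
  have : (⋃ u ∈ (Finset.univ : Finset (Fin k → Fin m)), cyl u) = univ := by
    ext i; simp [cyl]
  rw [this]; simp

theorem cyl_zero {m : ℕ} (u : Fin 0 → Fin m) : cyl u = univ := by
  ext i
  simpa [cyl] using Subsingleton.elim _ _

/-- A Gibbs measure is quasi-Bernoulli, with positive mass on each cylinder. -/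
theorem IsGibbs.exists_quasiBernoulli {m : ℕ} (hm : 0 < m) {μ : Measure (Code m)}
    (hμ : IsGibbs μ) :
    ∃ K : ℝ, 1 ≤ K ∧ ∀ (k l : ℕ) (u : Fin k → Fin m) (v : Fin l → Fin m),
      0 < μ.real (cyl u) ∧
      μ.real (cyl (Fin.append u v)) ≤ K * (μ.real (cyl u) * μ.real (cyl v)) ∧
      μ.real (cyl u) * μ.real (cyl v) ≤ K * μ.real (cyl (Fin.append u v)) := by
  obtain ⟨hP, f, -, P, a, ha, hG⟩ := hμ
  set G : ℕ → Code m → ℝ := fun k i =>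
    Real.exp (-(k : ℝ) * P + ∑ j ∈ Finset.range k, f (shift^[j] i)) with hGdef
  have hG0 : ∀ k i, 0 < G k i := fun k i => Real.exp_pos _
  have hGadd : ∀ k l i, G (k + l) i = G k i * G l (shift^[k] i) := by
    intro k l i
    simp only [hGdef]
    rw [← Real.exp_add, Finset.sum_range_add]
    congr 1
    have : ∀ j, shift^[k + j] i = shift^[j] (shift^[k] i) := fun j => by
      rw [add_comm, Function.iterate_add_apply]
    simp only [this]
    push_cast
    ring
  -- The maximum with `1` extends the Gibbs estimate to `k = 0`.
  set b := max a 1 with hb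
  have hb1 : 1 ≤ b := le_max_right _ _
  have hb0 : 0 < b := by linarith
  have hbound : ∀ k i, G k i ≤ b * μ.real (cyl (curtail i k)) ∧
      μ.real (cyl (curtail i k)) ≤ b * G k i := by
    intro k i
    rcases Nat.eq_zero_or_pos k with rfl | hk
    · simp [hGdef, cyl_zero, hb1]
    · obtain ⟨h1, h2⟩ := hG i k hk
      rw [le_div_iff₀ (hG0 k i), inv_mul_le_iff₀ ha] at h1
      rw [div_le_iff₀ (hG0 k i)] at h2
      exact ⟨h1.trans (mul_le_mul_of_nonneg_right (le_max_left _ _) measureReal_nonneg),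
        h2.trans (mul_le_mul_of_nonneg_right (le_max_left _ _) (hG0 k i).le)⟩
  -- One factor `b` for each of the three cylinders compared with the multiplicative weight `G`.
  refine ⟨b ^ 3, one_le_pow₀ hb1, fun k l u v => ?_⟩
  obtain ⟨i, hi⟩ := exists_mem_cyl hm (Fin.append u v)
  have hi' : i ∈ cyl (Fin.append u v) := hi
  obtain ⟨hu, hv⟩ := mem_cyl_append.1 hi'
  change curtail i k = u at hu
  change curtail (shift^[k] i) l = v at hv
  obtain ⟨u1, u2⟩ := hbound k i
  obtain ⟨v1, v2⟩ := hbound l (shift^[k] i)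
  obtain ⟨w1, w2⟩ := hbound (k + l) i
  rw [hu] at u1 u2
  rw [hv] at v1 v2
  rw [hi, hGadd] at w1 w2
  have g1 := hG0 k i
  have g2 := hG0 l (shift^[k] i)
  refine ⟨?_, ?_, ?_⟩
  · by_contra hneg
    have : μ.real (cyl u) = 0 := le_antisymm (not_lt.1 hneg) measureReal_nonneg
    rw [this, mul_zero] at u1
    linarith
  · calc _ ≤ _ := w2
      _ ≤ b * ((b * μ.real (cyl u)) * (b * μ.real (cyl v))) := by gcongr
      _ = _ := by ring
  · calc _ ≤ (b * G k i) * (b * G l (shift^[k] i)) :=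
          mul_le_mul u2 v2 measureReal_nonneg (by positivity)
      _ = b ^ 2 * (G k i * G l (shift^[k] i)) := by ring
      _ ≤ b ^ 2 * (b * μ.real (cyl (Fin.append u v))) := by gcongr
      _ = _ := by ring

theorem IsGibbs.measure_cyl_pos {m k : ℕ} (hm : 0 < m) {μ : Measure (Code m)}
    (hμ : IsGibbs μ) (u : Fin k → Fin m) : 0 < μ.real (cyl u) := by
  obtain ⟨K, -, h⟩ := hμ.exists_quasiBernoulli hm
  exact (h k k u u).1

/-- The cylinder masses of a Gibbs measure decay exponentially. -/
theorem IsGibbs.exists_measure_cyl_le {m : ℕ} (hm : 2 ≤ m) {μ : Measure (Code m)}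
    (hμ : IsGibbs μ) :
    ∃ r : ℝ, 0 < r ∧ r < 1 ∧ ∀ (k : ℕ) (u : Fin k → Fin m), μ.real (cyl u) ≤ r ^ k := by
  have hP : IsProbabilityMeasure μ := hμ.1
  have hm0 : 0 < m := by omega
  obtain ⟨K, hK, hq⟩ := hμ.exists_quasiBernoulli hm0
  have hK0 : 0 < K := by linarith
  have : Nonempty (Fin 1 → Fin m) := ⟨fun _ => ⟨0, hm0⟩⟩
  obtain ⟨v₀, hv₀⟩ := Finite.exists_min fun v : Fin 1 → Fin m => μ.real (cyl v)
  have hδ : 0 < μ.real (cyl v₀) / K := div_pos (hμ.measure_cyl_pos hm0 v₀) hK0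
  have hother : ∀ v : Fin 1 → Fin m, ∃ v', v' ≠ v := by
    intro v
    have : Nontrivial (Fin m) := Fin.nontrivial_iff_two_le.2 hm
    obtain ⟨j, hj⟩ := exists_ne (v 0)
    exact ⟨fun _ => j, fun h => hj (congrFun h 0)⟩
  -- A sibling cylinder, ending in another letter, keeps at least the proportion `μ(C_{v₀}) / K` of
  -- the mass of `C_u`, where `v₀` is the letter of least mass.
  have hstep : ∀ (k : ℕ) (u : Fin k → Fin m) (v : Fin 1 → Fin m),
      μ.real (cyl (Fin.append u v)) ≤ (1 - μ.real (cyl v₀) / K) * μ.real (cyl u) := by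
    intro k u v
    obtain ⟨v', hv'⟩ := hother v
    have hdisj : Disjoint (cyl (Fin.append u v)) (cyl (Fin.append u v')) :=
      Set.disjoint_left.2 fun i hi hi' => hv'
        ((mem_cyl_append.1 hi').2.symm.trans (mem_cyl_append.1 hi).2)
    have h1 : μ.real (cyl (Fin.append u v)) + μ.real (cyl (Fin.append u v')) ≤ μ.real (cyl u) := by
      rw [← measureReal_union hdisj (measurableSet_cyl _)]
      exact measureReal_mono (union_subset (fun i hi => (mem_cyl_append.1 hi).1)
        fun i hi => (mem_cyl_append.1 hi).1)
    have h2 := (hq k 1 u v').2.2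
    have h3 : μ.real (cyl u) * μ.real (cyl v₀) ≤ K * μ.real (cyl (Fin.append u v')) :=
      (mul_le_mul_of_nonneg_left (hv₀ v') measureReal_nonneg).trans h2
    have h4 : μ.real (cyl v₀) / K * μ.real (cyl u) ≤ μ.real (cyl (Fin.append u v')) := by
      rw [div_mul_eq_mul_div, div_le_iff₀ hK0]
      linarith
    linarith
  have hr : 0 < 1 - μ.real (cyl v₀) / K := by
    have h := hstep 0 Fin.elim0 v₀
    rw [cyl_zero Fin.elim0, probReal_univ, mul_one] at h
    exact (hμ.measure_cyl_pos hm0 _).trans_le h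
  refine ⟨_, hr, by linarith, fun k u => ?_⟩
  induction k, u using word_induction with
  | h0 u => simp [cyl_zero]
  | h1 k u v ih =>
    rw [pow_succ']
    exact (hstep k u v).trans (mul_le_mul_of_nonneg_left ih hr.le)

/-! ### The pressure and its zeros. -/

/-- The sum over the words of length `k` that defines the pressure. -/
noncomputable def wordSum {m N : ℕ} (T : Fin m → E N →L[ℝ] E N) (μ : Measure (Code m)) (s q : ℝ)
    (k : ℕ) : ℝ :=
  ∑ u : Fin k → Fin m, phi s (wordMap T u) ^ (1 - q) * μ.real (cyl u) ^ q

theorem pressureSeq_eq {m N : ℕ} (T : Fin m → E N →L[ℝ] E N) (μ : Measure (Code m)) {s q : ℝ}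
    (hq : q < 1) (k : ℕ) :
    pressureSeq T μ s q k = Real.log (wordSum T μ s q k) / k / (q - 1) := by
  rw [pressureSeq, if_neg hq.ne, wordSum]
  ring

theorem pressureSeq_eq_neg {m N : ℕ} (T : Fin m → E N →L[ℝ] E N) (μ : Measure (Code m)) {s q : ℝ}
    (hq : q < 1) (k : ℕ) :
    pressureSeq T μ s q k = -(Real.log (wordSum T μ s q k) / (k * (1 - q))) := by
  rw [pressureSeq_eq T μ hq, ← neg_sub 1 q, div_neg, div_div]

section Pressure

variable {m N : ℕ} (hm : 2 ≤ m) (hN : 1 ≤ N) {T : Fin m → E N →L[ℝ] E N}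
  (hT : ∀ i, ‖T i‖ < 1) (hTinj : ∀ i, Function.Injective (T i))
  {μ : Measure (Code m)} (hμ : IsGibbs μ)

include hm hN hTinj hμ in
theorem wordSum_pos (s q : ℝ) (k : ℕ) : 0 < wordSum T μ s q k := by
  have : Nonempty (Fin k → Fin m) := ⟨fun _ => ⟨0, by omega⟩⟩
  exact Finset.sum_pos (fun u _ => mul_pos
    (Real.rpow_pos_of_pos (phi_pos hN s (wordMap_injective hTinj k u)) _)
    (Real.rpow_pos_of_pos (hμ.measure_cyl_pos (by omega) u) _)) Finset.univ_nonempty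

-- Submultiplicativity of `φ^s` meets the quasi-Bernoulli bound; since `K ≥ 1` and `q < 1`, `K ^ q ≤
-- K` makes the constant independent of `s` and `q`.
include hm hN hTinj hμ in
theorem exists_wordSum_add_le :
    ∃ K : ℝ, 1 ≤ K ∧ ∀ s q : ℝ, 0 ≤ s → q ∈ Ico (0 : ℝ) 1 → ∀ k l : ℕ,
      wordSum T μ s q (k + l) ≤ K * (wordSum T μ s q k * wordSum T μ s q l) := by
  have hm0 : 0 < m := by omega
  obtain ⟨K, hK, hq⟩ := hμ.exists_quasiBernoulli hm0
  have hK0 : 0 < K := by linarith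
  refine ⟨K, hK, fun s q hs hq01 k l => ?_⟩
  have hsum : wordSum T μ s q (k + l) = ∑ p : (Fin k → Fin m) × (Fin l → Fin m),
      phi s (wordMap T (Fin.append p.1 p.2)) ^ (1 - q) * μ.real (cyl (Fin.append p.1 p.2)) ^ q :=
    (Fintype.sum_equiv (Fin.appendEquiv k l) _ _ fun p => rfl).symm
  rw [hsum, wordSum, wordSum, Finset.sum_mul_sum, Finset.mul_sum, ← Finset.univ_product_univ,
    Finset.sum_product]
  refine Finset.sum_le_sum fun u _ => ?_
  rw [Finset.mul_sum]
  refine Finset.sum_le_sum fun v _ => ?_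
  have iu := wordMap_injective hTinj k u
  have iv := wordMap_injective hTinj l v
  have pu := phi_pos hN s iu
  have pv := phi_pos hN s iv
  have mu := hμ.measure_cyl_pos hm0 u
  have mv := hμ.measure_cyl_pos hm0 v
  have h1 : phi s (wordMap T (Fin.append u v)) ^ (1 - q) ≤
      phi s (wordMap T u) ^ (1 - q) * phi s (wordMap T v) ^ (1 - q) := by
    rw [← Real.mul_rpow pu.le pv.le, wordMap_append]
    refine Real.rpow_le_rpow (phi_pos hN s (A := wordMap T u * wordMap T v) (iu.comp iv)).le (phi_mul_le hN hs iu iv) ?_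
    linarith [hq01.2]
  have h2 : μ.real (cyl (Fin.append u v)) ^ q ≤
      K * (μ.real (cyl u) ^ q * μ.real (cyl v) ^ q) := by
    rw [← Real.mul_rpow mu.le mv.le]
    refine (Real.rpow_le_rpow measureReal_nonneg (hq k l u v).2.1 hq01.1).trans ?_
    rw [Real.mul_rpow hK0.le (by positivity)]
    refine mul_le_mul_of_nonneg_right ?_ (by positivity)
    simpa using Real.rpow_le_rpow_of_exponent_le hK hq01.2.le
  calc _ ≤ (phi s (wordMap T u) ^ (1 - q) * phi s (wordMap T v) ^ (1 - q)) *
        (K * (μ.real (cyl u) ^ q * μ.real (cyl v) ^ q)) :=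
        mul_le_mul h1 h2 (by positivity) (by positivity)
    _ = _ := by ring

include hN hTinj in
theorem wordSum_le_mul {ρ : ℝ} (hρ : 0 < ρ) (hTρ : ∀ i, ‖T i‖ ≤ ρ) {s t q : ℝ} (hs : 0 ≤ s)
    (hst : s ≤ t) (hq : q < 1) (k : ℕ) :
    wordSum T μ t q k ≤ wordSum T μ s q k * ((ρ ^ k) ^ (t - s)) ^ (1 - q) := by
  rw [wordSum, wordSum, Finset.sum_mul]
  refine Finset.sum_le_sum fun u _ => ?_
  have iu := wordMap_injective hTinj k u
  rw [mul_right_comm, ← Real.mul_rpow (phi_pos hN s iu).le (by positivity)]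
  refine mul_le_mul_of_nonneg_right (Real.rpow_le_rpow (phi_pos hN t iu).le
    (phi_le_mul_rpow hN hs hst iu (by positivity) (norm_wordMap_le hρ.le hTρ k u)) (by linarith))
    (Real.rpow_nonneg measureReal_nonneg _)

include hN hTinj in
theorem mul_le_wordSum {c : ℝ} (hc : 0 < c) (hTc : ∀ i x, c * ‖x‖ ≤ ‖T i x‖) {s t q : ℝ}
    (hs : 0 ≤ s) (hst : s ≤ t) (hq : q < 1) (k : ℕ) :
    wordSum T μ s q k * ((c ^ k) ^ (t - s)) ^ (1 - q) ≤ wordSum T μ t q k := by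
  rw [wordSum, wordSum, Finset.sum_mul]
  refine Finset.sum_le_sum fun u _ => ?_
  have iu := wordMap_injective hTinj k u
  rw [mul_right_comm, ← Real.mul_rpow (phi_pos hN s iu).le (by positivity)]
  refine mul_le_mul_of_nonneg_right (Real.rpow_le_rpow (mul_nonneg (phi_pos hN s iu).le
    (by positivity))
    (mul_rpow_le_phi hN hs hst iu (by positivity) (le_norm_wordMap hc.le hTc k u)) (by linarith))
    (Real.rpow_nonneg measureReal_nonneg _)

-- As `φ^0 = 1`, the sum is the `μ`-average of `μ(C_u)^(q-1)`, a negative power of masses that are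
-- at most `r ^ k`.
include hm hN hμ in
theorem rpow_le_wordSum_zero {r : ℝ} (hr : ∀ (k : ℕ) (u : Fin k → Fin m), μ.real (cyl u) ≤ r ^ k)
    {q : ℝ} (hq : q < 1) (k : ℕ) : (r ^ k) ^ (q - 1) ≤ wordSum T μ 0 q k := by
  have hP : IsProbabilityMeasure μ := hμ.1
  have h1 : (r ^ k) ^ (q - 1) = ∑ u : Fin k → Fin m, μ.real (cyl u) * (r ^ k) ^ (q - 1) := by
    rw [← Finset.sum_mul, sum_measure_cyl, one_mul]
  rw [h1, wordSum]
  refine Finset.sum_le_sum fun u _ => ?_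
  have mu := hμ.measure_cyl_pos (by omega : 0 < m) u
  rw [phi_zero hN, Real.one_rpow, one_mul]
  calc _ ≤ μ.real (cyl u) * μ.real (cyl u) ^ (q - 1) :=
        mul_le_mul_of_nonneg_left
          (Real.rpow_le_rpow_of_nonpos mu (hr k u) (by linarith)) mu.le
    _ = _ := by
        rw [Real.rpow_sub_one mu.ne']
        field_simp

-- Fekete's lemma. Adding `log K` makes the logarithms subadditive, and comparison with `s = 0`
-- bounds them below linearly in `k`.
include hm hN hTinj hμ in
theorem exists_tendsto_log_wordSum {s q : ℝ} (hs : 0 ≤ s) (hq : q ∈ Ico (0 : ℝ) 1) :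
    ∃ l : ℝ, Tendsto (fun k : ℕ => Real.log (wordSum T μ s q k) / k) atTop (𝓝 l) := by
  have hP : IsProbabilityMeasure μ := hμ.1
  obtain ⟨K, hK, hadd⟩ := exists_wordSum_add_le hm hN hTinj hμ
  have hpos := fun k => wordSum_pos hm hN hTinj hμ s q k
  have hsub : Subadditive fun k => Real.log (wordSum T μ s q k) + Real.log K := by
    intro k l
    have h := Real.log_le_log (hpos _) (hadd s q hs hq k l)
    rw [Real.log_mul (by positivity) (mul_pos (hpos k) (hpos l)).ne',
      Real.log_mul (hpos k).ne' (hpos l).ne'] at h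
    linarith
  obtain ⟨c, hc0, hc1, hc⟩ := exists_pos_lower_bound hTinj
  obtain ⟨r, hr0, hr1, hr⟩ := hμ.exists_measure_cyl_le hm
  have hlow : ∀ k : ℕ, k * (s * (1 - q) * Real.log c) ≤ Real.log (wordSum T μ s q k) := by
    intro k
    have h1 := mul_le_wordSum (μ := μ) hN hTinj hc0 hc le_rfl hs hq.2 k
    have h2 : 1 ≤ wordSum T μ 0 q k :=
      (Real.one_le_rpow_of_pos_of_le_one_of_nonpos (by positivity) (pow_le_one₀ hr0.le hr1.le)
        (by linarith [hq.2])).trans (rpow_le_wordSum_zero hm hN hμ hr hq.2 k)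
    have h3 : ((c ^ k) ^ (s - 0)) ^ (1 - q) ≤ wordSum T μ s q k :=
      (le_mul_of_one_le_left (by positivity) h2).trans h1
    have h4 := Real.log_le_log (by positivity) h3
    rw [Real.log_rpow (by positivity), Real.log_rpow (by positivity), Real.log_pow, sub_zero] at h4
    linarith
  have hbdd : BddBelow (range fun k : ℕ => (Real.log (wordSum T μ s q k) + Real.log K) / k) := by
    -- The `0` covers the term `k = 0`, where the quotient is `0` by convention.
    refine ⟨min 0 (s * (1 - q) * Real.log c), ?_⟩
    rintro _ ⟨k, rfl⟩
    rcases Nat.eq_zero_or_pos k with rfl | hk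
    · simp
    · have hk' : (0 : ℝ) < k := by exact_mod_cast hk
      refine (min_le_right _ _).trans ?_
      rw [le_div_iff₀ hk']
      linarith [hlow k, Real.log_nonneg hK]
  refine ⟨hsub.lim, ?_⟩
  have h1 := hsub.tendsto_lim hbdd
  have h2 : Tendsto (fun k : ℕ => Real.log K / k) atTop (𝓝 0) :=
    tendsto_const_div_atTop_nhds_zero_nat _
  refine (by simpa using h1.sub h2 : Tendsto _ _ _).congr fun k => ?_
  ring

include hm hN hTinj hμ in
theorem tendsto_pressureSeq {s q : ℝ} (hs : 0 ≤ s) (hq : q ∈ Ico (0 : ℝ) 1) :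
    Tendsto (pressureSeq T μ s q) atTop (𝓝 (pressure T μ s q)) := by
  obtain ⟨l, hl⟩ := exists_tendsto_log_wordSum hm hN hTinj hμ hs hq
  have h : Tendsto (pressureSeq T μ s q) atTop (𝓝 (l / (q - 1))) :=
    (hl.div_const (q - 1)).congr fun k => (pressureSeq_eq T μ hq.2 k).symm
  exact tendsto_nhds_limUnder ⟨_, h⟩

include hm hN hTinj hμ in
theorem tendsto_log_wordSum {s q : ℝ} (hs : 0 ≤ s) (hq : q ∈ Ico (0 : ℝ) 1) :
    Tendsto (fun k : ℕ => Real.log (wordSum T μ s q k) / k) atTop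
      (𝓝 ((q - 1) * pressure T μ s q)) := by
  refine ((tendsto_pressureSeq hm hN hTinj hμ hs hq).const_mul (q - 1)).congr fun k => ?_
  rw [pressureSeq_eq T μ hq.2, mul_div_cancel₀ _ (by linarith [hq.2])]

-- Passing from `s` to `t` multiplies the word sum by at most `ρ^(k(t-s)(1-q))`. Dividing the
-- logarithm by `k(q-1) < 0` reverses the inequality and leaves linear growth.
include hm hN hTinj hμ in
theorem add_le_pressure {ρ : ℝ} (hρ : 0 < ρ) (hTρ : ∀ i, ‖T i‖ ≤ ρ) {s t q : ℝ} (hs : 0 ≤ s)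
    (hst : s ≤ t) (hq : q ∈ Ico (0 : ℝ) 1) :
    pressure T μ s q + (t - s) * -Real.log ρ ≤ pressure T μ t q := by
  refine le_of_tendsto_of_tendsto ((tendsto_pressureSeq hm hN hTinj hμ hs hq).add_const _)
    (tendsto_pressureSeq hm hN hTinj hμ (hs.trans hst) hq) ?_
  filter_upwards [eventually_gt_atTop 0] with k hk
  have hk' : (0 : ℝ) < k := by exact_mod_cast hk
  have hq1 : 0 < 1 - q := by linarith [hq.2]
  have p := wordSum_pos hm hN hTinj hμ s q k
  have h := Real.log_le_log (wordSum_pos hm hN hTinj hμ t q k)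
    (wordSum_le_mul (μ := μ) hN hTinj hρ hTρ hs hst hq.2 k)
  rw [Real.log_mul p.ne' (by positivity), Real.log_rpow (by positivity),
    Real.log_rpow (by positivity), Real.log_pow] at h
  have h1 : Real.log (wordSum T μ t q k) / (k * (1 - q)) ≤
      Real.log (wordSum T μ s q k) / (k * (1 - q)) - (t - s) * -Real.log ρ := by
    rw [div_le_iff₀ (by positivity), sub_mul, div_mul_cancel₀ _ (by positivity)]
    linarith
  rw [pressureSeq_eq_neg T μ hq.2, pressureSeq_eq_neg T μ hq.2]
  linarith

-- This upper growth rate supplies the Lipschitz continuity needed for the intermediate value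
-- theorem.
include hm hN hTinj hμ in
theorem pressure_le_add {c : ℝ} (hc : 0 < c) (hTc : ∀ i x, c * ‖x‖ ≤ ‖T i x‖) {s t q : ℝ}
    (hs : 0 ≤ s) (hst : s ≤ t) (hq : q ∈ Ico (0 : ℝ) 1) :
    pressure T μ t q ≤ pressure T μ s q + (t - s) * -Real.log c := by
  refine le_of_tendsto_of_tendsto (tendsto_pressureSeq hm hN hTinj hμ (hs.trans hst) hq)
    ((tendsto_pressureSeq hm hN hTinj hμ hs hq).add_const _) ?_
  filter_upwards [eventually_gt_atTop 0] with k hk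
  have hk' : (0 : ℝ) < k := by exact_mod_cast hk
  have hq1 : 0 < 1 - q := by linarith [hq.2]
  have p := wordSum_pos hm hN hTinj hμ s q k
  have h := Real.log_le_log (by positivity)
    (mul_le_wordSum (μ := μ) hN hTinj hc hTc hs hst hq.2 k)
  rw [Real.log_mul p.ne' (by positivity), Real.log_rpow (by positivity),
    Real.log_rpow (by positivity), Real.log_pow] at h
  have h1 : Real.log (wordSum T μ s q k) / (k * (1 - q)) - (t - s) * -Real.log c ≤
      Real.log (wordSum T μ t q k) / (k * (1 - q)) := by
    rw [le_div_iff₀ (by positivity), sub_mul, div_mul_cancel₀ _ (by positivity)]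
    linarith
  rw [pressureSeq_eq_neg T μ hq.2, pressureSeq_eq_neg T μ hq.2]
  linarith

include hm hN hTinj hμ in
theorem pressure_zero_neg {q : ℝ} (hq : q ∈ Ico (0 : ℝ) 1) : pressure T μ 0 q < 0 := by
  obtain ⟨r, hr0, hr1, hr⟩ := hμ.exists_measure_cyl_le hm
  refine lt_of_le_of_lt ?_ (Real.log_neg hr0 hr1)
  refine le_of_tendsto (tendsto_pressureSeq hm hN hTinj hμ le_rfl hq) ?_
  filter_upwards [eventually_gt_atTop 0] with k hk
  have hk' : (0 : ℝ) < k := by exact_mod_cast hk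
  have h := Real.log_le_log (by positivity) (rpow_le_wordSum_zero (T := T) hm hN hμ hr hq.2 k)
  rw [Real.log_rpow (by positivity), Real.log_pow] at h
  rw [pressureSeq_eq T μ hq.2, div_le_iff_of_neg (by linarith [hq.2]), le_div_iff₀ hk']
  linarith

-- The word sum is the `μ`-average of `(φ^s(T_u) / μ(C_u))^(1-q)`. By Jensen, power means increase
-- with the exponent `1 - q`; the sign of `q - 1` turns this into growth of the pressure in `q`.
include hm hN hTinj hμ in
theorem pressure_mono_exponent {s p q : ℝ} (hs : 0 ≤ s) (hp : p ∈ Ico (0 : ℝ) 1)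
    (hq : q ∈ Ico (0 : ℝ) 1) (hpq : p ≤ q) : pressure T μ s p ≤ pressure T μ s q := by
  have hP : IsProbabilityMeasure μ := hμ.1
  refine le_of_tendsto_of_tendsto' (tendsto_pressureSeq hm hN hTinj hμ hs hp)
    (tendsto_pressureSeq hm hN hTinj hμ hs hq) fun k => ?_
  have hp1 : 0 < 1 - p := by linarith [hp.2]
  have hq1 : 0 < 1 - q := by linarith [hq.2]
  have hpos := fun q => wordSum_pos hm hN hTinj hμ s q k
  have hw : ∀ q, wordSum T μ s q k = ∑ u : Fin k → Fin m,
      μ.real (cyl u) * (phi s (wordMap T u) / μ.real (cyl u)) ^ (1 - q) := by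
    intro q
    refine Finset.sum_congr rfl fun u _ => ?_
    have mu := hμ.measure_cyl_pos (by omega : 0 < m) u
    rw [Real.div_rpow (phi_pos hN s (wordMap_injective hTinj k u)).le mu.le, Real.rpow_sub mu,
      Real.rpow_one]
    have := Real.rpow_pos_of_pos mu q
    field_simp
  have hJ : wordSum T μ s q k ^ ((1 - p) / (1 - q)) ≤ wordSum T μ s p k := by
    rw [hw p, hw q]
    have hz : ∀ u : Fin k → Fin m, 0 ≤ phi s (wordMap T u) / μ.real (cyl u) := fun u =>
      div_nonneg (phi_pos hN s (wordMap_injective hTinj k u)).le measureReal_nonneg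
    refine (Real.rpow_arith_mean_le_arith_mean_rpow Finset.univ (fun u => μ.real (cyl u)) _
      (fun u _ => measureReal_nonneg) (sum_measure_cyl μ k)
      (fun u _ => Real.rpow_nonneg (hz u) (1 - q))
      ((one_le_div hq1).2 (by linarith))).trans (le_of_eq ?_)
    refine Finset.sum_congr rfl fun u _ => ?_
    rw [← Real.rpow_mul (hz u), mul_div_cancel₀ _ hq1.ne']
  have h := Real.log_le_log (Real.rpow_pos_of_pos (hpos q) _) hJ
  rw [Real.log_rpow (hpos q)] at h
  rw [pressureSeq_eq T μ hp.2, pressureSeq_eq T μ hq.2, div_right_comm, div_right_comm _ (k : ℝ)]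
  refine div_le_div_of_nonneg_right ?_ (Nat.cast_nonneg k)
  rw [← neg_sub 1 p, ← neg_sub 1 q, div_neg, div_neg, neg_le_neg_iff, div_le_div_iff₀ hq1 hp1]
  rw [div_mul_eq_mul_div, div_le_iff₀ hq1] at h
  linarith

include hm hN hT hTinj hμ in
theorem existsUnique_pressure_eq_zero {q : ℝ} (hq : q ∈ Ico (0 : ℝ) 1) :
    ∃! d : ℝ, 0 < d ∧ pressure T μ d q = 0 := by
  obtain ⟨ρ, hρ0, hρ1, hρ⟩ := exists_norm_le_lt_one hT
  obtain ⟨c, hc0, hc1, hc⟩ := exists_pos_lower_bound hTinj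
  have hlρ : 0 < -Real.log ρ := neg_pos.2 (Real.log_neg hρ0 hρ1)
  have hlc : 0 < -Real.log c := neg_pos.2 (Real.log_neg hc0 hc1)
  have hlow := fun {s t : ℝ} (hs : 0 ≤ s) (hst : s ≤ t) =>
    add_le_pressure hm hN hTinj hμ hρ0 hρ hs hst hq
  have hup := fun {s t : ℝ} (hs : 0 ≤ s) (hst : s ≤ t) =>
    pressure_le_add hm hN hTinj hμ hc0 hc hs hst hq
  have h0 := pressure_zero_neg hm hN hTinj hμ hq
  have hcont : ContinuousOn (fun s => pressure T μ s q) (Ici 0) := by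
    refine (LipschitzOnWith.of_le_add_mul (Real.toNNReal (-Real.log c)) ?_).continuousOn
    intro s hs t ht
    rw [Real.coe_toNNReal _ hlc.le]
    rcases le_total s t with hst | hst
    · have h1 := hlow hs hst
      have h2 : 0 ≤ (t - s) * -Real.log ρ := mul_nonneg (by linarith) hlρ.le
      have h3 : 0 ≤ -Real.log c * dist s t := mul_nonneg hlc.le dist_nonneg
      linarith
    · rw [Real.dist_eq, abs_of_nonneg (by linarith)]
      linarith [hup ht hst]
  -- The point where the linear lower bound for the pressure, started at `s = 0`, reaches `0`.
  set b := -pressure T μ 0 q / -Real.log ρ with hb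
  have hb0 : 0 ≤ b := div_nonneg (by linarith) hlρ.le
  have hPb : 0 ≤ pressure T μ b q := by
    have h := hlow le_rfl hb0
    rw [sub_zero, hb, div_mul_cancel₀ _ hlρ.ne', ← hb] at h
    linarith
  obtain ⟨d, hd, hPd⟩ := intermediate_value_Icc hb0 (hcont.mono Icc_subset_Ici_self)
    (show (0 : ℝ) ∈ Icc (pressure T μ 0 q) (pressure T μ b q) from ⟨h0.le, hPb⟩)
  have hd0 : 0 < d := by
    refine lt_of_le_of_ne hd.1 fun h => ?_
    rw [← h] at hPd
    exact h0.ne hPd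
  refine ⟨d, ⟨hd0, hPd⟩, fun e he => ?_⟩
  have key : ∀ x y : ℝ, 0 < x → pressure T μ x q = 0 → pressure T μ y q = 0 → ¬ x < y := by
    intro x y hx hPx hPy hxy
    have h := hlow hx.le hxy.le
    have h2 : 0 < (y - x) * -Real.log ρ := mul_pos (by linarith) hlρ
    linarith
  exact le_antisymm (not_lt.1 (key d e hd0 hPd he.2)) (not_lt.1 (key e d he.1 he.2 hPd))

include hm hN hT hTinj hμ in
theorem dimZero_spec {q : ℝ} (hq : q ∈ Ico (0 : ℝ) 1) :
    0 < dimZero T μ q ∧ pressure T μ (dimZero T μ q) q = 0 :=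
  Classical.epsilon_spec (existsUnique_pressure_eq_zero hm hN hT hTinj hμ hq).exists

include hm hN hT hTinj hμ in
theorem pressure_pos_of_dimZero_lt {d q : ℝ} (hq : q ∈ Ico (0 : ℝ) 1) (hd : dimZero T μ q < d) :
    0 < pressure T μ d q := by
  obtain ⟨ρ, hρ0, hρ1, hρ⟩ := exists_norm_le_lt_one hT
  obtain ⟨h1, h2⟩ := dimZero_spec hm hN hT hTinj hμ hq
  have h := add_le_pressure hm hN hTinj hμ hρ0 hρ h1.le hd.le hq
  have h3 : 0 < (d - dimZero T μ q) * -Real.log ρ :=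
    mul_pos (by linarith) (neg_pos.2 (Real.log_neg hρ0 hρ1))
  linarith

-- If `d_p < d_q` with `p ≤ q`, then `P(d_q, p) > 0 = P(d_q, q)`, against monotonicity of the
-- pressure in `q`.
include hm hN hT hTinj hμ in
theorem antitoneOn_dimZero : AntitoneOn (dimZero T μ) (Ico 0 1) := by
  intro p hp q hq hpq
  by_contra h
  have hp0 := dimZero_spec hm hN hT hTinj hμ hp
  have h1 := pressure_pos_of_dimZero_lt hm hN hT hTinj hμ hp (not_le.1 h)
  have hq0 := dimZero_spec hm hN hT hTinj hμ hq
  have h2 := pressure_mono_exponent hm hN hTinj hμ hq0.1.le hp hq hpq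
  linarith [hq0.2]

include hm hN hT hTinj hμ in
theorem exists_tendsto_dimZero : ∃ L : ℝ, 0 ≤ L ∧ Tendsto (dimZero T μ) (𝓝[<] 1) (𝓝 L) := by
  have hlb : ∀ x ∈ dimZero T μ '' Ioo 0 1, 0 ≤ x := by
    rintro _ ⟨q, hq, rfl⟩
    exact (dimZero_spec hm hN hT hTinj hμ ⟨hq.1.le, hq.2⟩).1.le
  exact ⟨_, Real.sInf_nonneg hlb, AntitoneOn.tendsto_nhdsWithin_Ioo_left (by simp)
    ((antitoneOn_dimZero hm hN hT hTinj hμ).mono Ioo_subset_Ico_self) ⟨0, hlb⟩⟩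

include hm hN hT hTinj hμ in
/-- Above the limit of the zeros, the sums that define the pressure are summable for some `q`. -/
theorem exists_summable_wordSum {L d : ℝ} (hL : Tendsto (dimZero T μ) (𝓝[<] 1) (𝓝 L))
    (hd0 : 0 ≤ d) (hd : L < d) : ∃ q ∈ Ico (0 : ℝ) 1, Summable (wordSum T μ d q) := by
  have hev : ∀ᶠ q in 𝓝[<] (1 : ℝ), q ∈ Ico (0 : ℝ) 1 ∧ dimZero T μ q < d := by
    filter_upwards [hL.eventually (gt_mem_nhds hd), Ioo_mem_nhdsLT (zero_lt_one' ℝ)] with q h1 h2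
    exact ⟨⟨h2.1.le, h2.2⟩, h1⟩
  obtain ⟨q, hq, hqd⟩ := hev.exists
  refine ⟨q, hq, ?_⟩
  have hP := pressure_pos_of_dimZero_lt hm hN hT hTinj hμ hq hqd
  have hneg : (q - 1) * pressure T μ d q < 0 := mul_neg_of_neg_of_pos (by linarith [hq.2]) hP
  -- The word sums are eventually at most `exp(kη)` with `η < 0`, a convergent geometric series.
  obtain ⟨η, hη1, hη0⟩ := exists_between hneg
  have hlim := (tendsto_log_wordSum hm hN hTinj hμ hd0 hq).eventually (gt_mem_nhds hη1)
  have hs : Summable fun k : ℕ => Real.exp η ^ k :=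
    summable_geometric_of_lt_one (Real.exp_pos _).le (Real.exp_lt_one_iff.2 hη0)
  refine hs.of_norm_bounded_eventually_nat ?_
  filter_upwards [hlim, eventually_gt_atTop 0] with k hk hk0
  have hpos := wordSum_pos hm hN hTinj hμ d q k
  have hk' : (0 : ℝ) < k := by exact_mod_cast hk0
  rw [Real.norm_of_nonneg hpos.le, ← Real.exp_nat_mul, ← Real.log_le_iff_le_exp hpos]
  rw [div_lt_iff₀ hk'] at hk
  linarith

end Pressure

/-! ### Masses of small balls and upper local dimension. -/

/-- The points with a ball of small mass have small total mass, if their images are covered by few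
sets of small diameter: two points in the same unit cell of the chart `g` have images at distance
at most `r`. -/
theorem measure_small_ball_le {X : Type*} [MeasurableSpace X] (μ : Measure X) {N : ℕ}
    {π : X → E N} (hπ : Measurable π) {S : Set X} {g : X → Fin N → ℝ} {l : Fin N → ℝ}
    (hl : ∀ i ∈ S, ∀ j, |g i j| ≤ l j) {r : ℝ}
    (hr : ∀ i ∈ S, ∀ i' ∈ S, (∀ j, |g i j - g i' j| ≤ 1) → dist (π i) (π i') ≤ r) (t : ENNReal) :
    μ {i ∈ S | μ.map π (Metric.closedBall (π i) r) < t} ≤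
      ENNReal.ofReal (∏ j, (2 * l j + 2)) * t := by
  set Bad := {i ∈ S | μ.map π (Metric.closedBall (π i) r) < t} with hBad
  rcases Bad.eq_empty_or_nonempty with he | ⟨i₀, hi₀⟩
  · rw [he]; simp
  have hl0 : ∀ j, 0 ≤ l j := fun j => (abs_nonneg _).trans (hl i₀ hi₀.1 j)
  let F : Finset (Fin N → ℤ) := Fintype.piFinset fun j => Finset.Icc ⌊-l j⌋ ⌊l j⌋
  have hcard : (F.card : ℝ) ≤ ∏ j, (2 * l j + 2) := by
    rw [Fintype.card_piFinset, Nat.cast_prod]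
    refine Finset.prod_le_prod (fun j _ => Nat.cast_nonneg _) fun j _ => ?_
    rw [Int.card_Icc]
    have h1 : ⌊-l j⌋ ≤ ⌊l j⌋ + 1 :=
      (Int.floor_le_floor (by linarith [hl0 j])).trans (by omega)
    have h2 : ((⌊l j⌋ + 1 - ⌊-l j⌋).toNat : ℝ) = ((⌊l j⌋ + 1 - ⌊-l j⌋ : ℤ) : ℝ) := by
      exact_mod_cast congrArg (Int.cast : ℤ → ℝ) (Int.toNat_of_nonneg (by omega))
    rw [h2]
    push_cast
    linarith [Int.floor_le (l j), Int.lt_floor_add_one (-l j)]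
  let cell : X → Fin N → ℤ := fun i j => ⌊g i j⌋
  have hcover : Bad ⊆ ⋃ z ∈ F, {i ∈ Bad | cell i = z} := by
    intro i hi
    simp only [mem_iUnion]
    refine ⟨cell i, Fintype.mem_piFinset.2 fun j => ?_, hi, rfl⟩
    obtain ⟨h1, h2⟩ := abs_le.1 (hl i hi.1 j)
    exact Finset.mem_Icc.2 ⟨Int.floor_le_floor h1, Int.floor_le_floor h2⟩
  -- A cell with a bad point lies in the preimage of the ball about the image of that point, whose
  -- mass is below `t`.
  have hcell : ∀ z ∈ F, μ {i ∈ Bad | cell i = z} ≤ t := by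
    intro z _
    rcases {i ∈ Bad | cell i = z}.eq_empty_or_nonempty with he | ⟨i, hi, hiz⟩
    · rw [he]; simp
    have hsub : {i ∈ Bad | cell i = z} ⊆ π ⁻¹' Metric.closedBall (π i) r := by
      rintro i' ⟨hi', hiz'⟩
      refine hr i' hi'.1 i hi.1 fun j => ?_
      have hfl : ⌊g i' j⌋ = ⌊g i j⌋ := congrFun (hiz'.trans hiz.symm) j
      exact (Int.abs_sub_lt_one_of_floor_eq_floor hfl).le
    refine (measure_mono hsub).trans ?_
    rw [← Measure.map_apply hπ Metric.isClosed_closedBall.measurableSet]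
    exact hi.2.le
  calc μ Bad ≤ μ (⋃ z ∈ F, {i ∈ Bad | cell i = z}) := measure_mono hcover
    _ ≤ ∑ z ∈ F, μ {i ∈ Bad | cell i = z} := measure_biUnion_finset_le _ _
    _ ≤ F.card • t := Finset.sum_le_card_nsmul _ _ _ hcell
    _ = ENNReal.ofReal F.card * t := by
        rw [nsmul_eq_mul, ENNReal.ofReal_natCast]
    _ ≤ _ := by gcongr

/-- A power lower bound along a sequence of radii with bounded ratios holds for all small radii. -/
theorem eventually_rpow_le_of_seq {F : ℝ → ENNReal} (hF : Monotone F) {ε : ℕ → ℝ}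
    (hε0 : ∀ k, 0 < ε k) (hε : Tendsto ε atTop (𝓝 0)) {κ D d : ℝ} (hκ : 0 < κ)
    (hκε : ∀ k, κ * ε k ≤ ε (k + 1)) (hD : 0 < D) (hd : 0 ≤ d)
    (h : ∀ᶠ k in atTop, ENNReal.ofReal (ε k ^ d) ≤ F (D * ε k)) :
    ∀ᶠ r in 𝓝[>] (0 : ℝ), ENNReal.ofReal ((κ / D * r) ^ d) ≤ F r := by
  obtain ⟨k₀, hk₀⟩ := eventually_atTop.1 h
  filter_upwards [Ioo_mem_nhdsGT (mul_pos hD (hε0 k₀))] with r hr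
  -- Take the first such `k`. The restriction on `r` excludes `k = k₀`, so the preceding radius
  -- exceeds `r` and the ratio bound gives `ε k ≥ κ r / D`.
  have hex : ∃ k, k₀ ≤ k ∧ D * ε k ≤ r := by
    have h1 : Tendsto (fun k => D * ε k) atTop (𝓝 0) := by simpa using hε.const_mul D
    obtain ⟨k, hk1, hk2⟩ := ((h1.eventually (gt_mem_nhds hr.1)).and (eventually_ge_atTop k₀)).exists
    exact ⟨k, hk2, hk1.le⟩
  classical
  obtain ⟨hk1, hk2⟩ := Nat.find_spec hex
  have hmin := fun j (hj : j < Nat.find hex) => Nat.find_min hex hj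
  set k := Nat.find hex
  clear_value k
  have hne : k ≠ k₀ := by
    intro hk
    rw [hk] at hk2
    exact absurd hr.2 (not_lt.2 hk2)
  obtain ⟨j, rfl⟩ : ∃ j, k = j + 1 := ⟨k - 1, by omega⟩
  have hj : r < D * ε j := by
    by_contra hcon
    exact hmin j (Nat.lt_succ_self j) ⟨by omega, not_lt.1 hcon⟩
  have hle : κ / D * r ≤ ε (j + 1) := by
    refine le_trans ?_ (hκε j)
    rw [div_mul_eq_mul_div, div_le_iff₀ hD]
    nlinarith
  calc ENNReal.ofReal ((κ / D * r) ^ d) ≤ ENNReal.ofReal (ε (j + 1) ^ d) :=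
        ENNReal.ofReal_le_ofReal (Real.rpow_le_rpow
          (mul_nonneg (by positivity) hr.1.le) hle hd)
    _ ≤ F (D * ε (j + 1)) := hk₀ _ hk1
    _ ≤ F r := hF hk2

theorem measurable_measure_closedBall {N : ℕ} (ν : Measure (E N)) [SFinite ν] (r : ℝ) :
    Measurable fun x => ν (Metric.closedBall x r) := by
  have hs : MeasurableSet {p : E N × E N | dist p.2 p.1 ≤ r} :=
    (isClosed_le (by fun_prop) continuous_const).measurableSet
  exact measurable_measure_prodMk_left hs

theorem monotone_measure_closedBall {N : ℕ} (ν : Measure (E N)) (x : E N) :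
    Monotone fun r => ν (Metric.closedBall x r) :=
  fun _ _ h => measure_mono (Metric.closedBall_subset_closedBall h)

/-- Dividing by `log r < 0` reverses the inequality, and `log b / log r → 0` removes the constant.
-/
theorem upperLocalDim_le {N : ℕ} {ν : Measure (E N)} {x : E N} {b d : ℝ} (hb : 0 < b)
    (h : ∀ᶠ r in 𝓝[>] (0 : ℝ), ENNReal.ofReal ((b * r) ^ d) ≤ ν (Metric.closedBall x r)) :
    upperLocalDim ν x ≤ d := by
  have hlim : Tendsto (fun r : ℝ => d * (Real.log b / Real.log r + 1)) (𝓝[>] 0) (𝓝 d) := by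
    have h1 : Tendsto (fun r : ℝ => Real.log b / Real.log r) (𝓝[>] 0) (𝓝 0) :=
      Real.tendsto_log_nhdsGT_zero.const_div_atBot _
    simpa using (h1.add_const 1).const_mul d
  have hlim' : Tendsto (fun r : ℝ => ((d * (Real.log b / Real.log r + 1) : ℝ) : EReal)) (𝓝[>] 0)
      (𝓝 (d : EReal)) := continuous_coe_real_ereal.continuousAt.tendsto.comp hlim
  rw [upperLocalDim, ← hlim'.limsup_eq]
  refine limsup_le_limsup ?_
  filter_upwards [h, Ioo_mem_nhdsGT (zero_lt_one' ℝ)] with r hr hr01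
  have hbr : 0 < b * r := mul_pos hb hr01.1
  have hlog : Real.log r < 0 := Real.log_neg hr01.1 hr01.2
  have h1 : ((d * Real.log (b * r) : ℝ) : EReal) ≤ ENNReal.log (ν (Metric.closedBall x r)) := by
    rw [← Real.log_rpow hbr, ← ENNReal.log_ofReal_of_pos (Real.rpow_pos_of_pos hbr d)]
    exact ENNReal.log_le_log hr
  refine (EReal.div_le_div_right_of_nonpos (by exact_mod_cast hlog.le) h1).trans (le_of_eq ?_)
  rw [← EReal.coe_div, Real.log_mul hb.ne' hr01.1.ne']
  have hne := hlog.ne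
  congr 1
  field_simp

/-- An almost sure power lower bound for the mass of small balls bounds the upper local dimension of
the image measure. -/
theorem ae_upperLocalDim_map_le {X : Type*} [MeasurableSpace X] (μ : Measure X)
    [IsProbabilityMeasure μ] {N : ℕ} {π : X → E N} (hπ : Measurable π) {b d : ℝ} (hb : 0 < b)
    (hd : 0 ≤ d)
    (h : ∀ᵐ i ∂μ, ∀ᶠ r in 𝓝[>] (0 : ℝ),
      ENNReal.ofReal ((b * r) ^ d) ≤ μ.map π (Metric.closedBall (π i) r)) :
    ∀ᵐ x ∂(μ.map π), upperLocalDim (μ.map π) x ≤ d := by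
  set ν := μ.map π with hν
  set ε : ℕ → ℝ := fun n => (1 / 2 : ℝ) ^ n with hε
  have hε0 : ∀ n, 0 < ε n := fun n => by positivity
  have hεlim : Tendsto ε atTop (𝓝 0) :=
    tendsto_pow_atTop_nhds_zero_of_lt_one (by norm_num) (by norm_num)
  -- Restricting to countably many radii makes this set measurable, so the almost sure statement can
  -- be transferred from `μ` to its image.
  set G := {x : E N | ∀ᶠ n in atTop,
    ENNReal.ofReal ((b * ε n) ^ d) ≤ ν (Metric.closedBall x (ε n))} with hG
  have hGm : MeasurableSet G := by
    simp only [hG, eventually_atTop, ofPred_exists, ofPred_forall]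
    exact .iUnion fun n => .iInter fun k => .iInter fun _ =>
      measurableSet_le measurable_const (measurable_measure_closedBall ν _)
  have hGae : ∀ᵐ x ∂ν, x ∈ G := by
    refine (ae_map_iff (p := (· ∈ G)) hπ.aemeasurable hGm).2 ?_
    filter_upwards [h] with i hi
    have h1 : Tendsto ε atTop (𝓝[>] 0) :=
      tendsto_nhdsWithin_iff.2 ⟨hεlim, Eventually.of_forall hε0⟩
    exact h1.eventually hi
  filter_upwards [hGae] with x hx
  refine upperLocalDim_le (b := 1 / 2 / b⁻¹) (by positivity)
    (eventually_rpow_le_of_seq (monotone_measure_closedBall ν x) (ε := fun n => b * ε n)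
      (fun n => mul_pos hb (hε0 n)) (by simpa using hεlim.const_mul b) (by norm_num)
      (fun n => le_of_eq ?_) (inv_pos.2 hb) hd ?_)
  · simp only [hε, pow_succ]; ring
  · filter_upwards [hx] with n hn
    rwa [inv_mul_cancel_left₀ hb.ne']

/-- The upper local dimension of a compactly supported image measure is at most the dimension of
the space. -/
theorem ae_upperLocalDim_map_le_of_dim_lt {X : Type*} [MeasurableSpace X] (μ : Measure X)
    [IsProbabilityMeasure μ] {N : ℕ} (hN : 1 ≤ N) {π : X → E N} (hπ : Measurable π) {R : ℝ}
    (hR : ∀ i, ‖π i‖ ≤ R) {d : ℝ} (hd : N < d) :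
    ∀ᵐ x ∂(μ.map π), upperLocalDim (μ.map π) x ≤ d := by
  have hX : Nonempty X := nonempty_of_isProbabilityMeasure μ
  have hR0 : 0 ≤ R := (norm_nonneg _).trans (hR hX.some)
  have hN0 : (0 : ℝ) < N := by exact_mod_cast hN
  have hd0 : 0 ≤ d := hN0.le.trans hd.le
  set D := √(N : ℝ) with hD
  have hD0 : 0 < D := Real.sqrt_pos.2 hN0
  set ε : ℕ → ℝ := fun n => (1 / 2 : ℝ) ^ n with hε
  have hε0 : ∀ n, 0 < ε n := fun n => by positivity
  have hε1 : ∀ n, ε n ≤ 1 := fun n => pow_le_one₀ (by norm_num) (by norm_num)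
  have hεlim : Tendsto ε atTop (𝓝 0) :=
    tendsto_pow_atTop_nhds_zero_of_lt_one (by norm_num) (by norm_num)
  set Bad : ℕ → Set X := fun k => {i ∈ univ |
    μ.map π (Metric.closedBall (π i) (D * ε k)) < ENNReal.ofReal (ε k ^ d)} with hBad
  -- The grid of mesh `2^(-k)` needs `O(2^(kN))` cells, each carrying bad mass at most `2^(-kd)`;
  -- the product is summable as `d > N`.
  have hbad : ∀ k, μ (Bad k) ≤ ENNReal.ofReal ((2 * R + 2) ^ N * ((1 / 2 : ℝ) ^ (d - N)) ^ k) := by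
    intro k
    refine (measure_small_ball_le μ hπ (g := fun i j => π i j / ε k) (l := fun _ => R / ε k)
      (fun i _ j => ?_) (fun i _ i' _ hii => ?_) _).trans ?_
    · rw [abs_div, abs_of_pos (hε0 k)]
      have := (PiLp.norm_apply_le (π i) j).trans (hR i)
      rw [Real.norm_eq_abs] at this
      have := hε0 k
      gcongr
    · rw [EuclideanSpace.dist_eq, hD, ← Real.sqrt_sq (hε0 k).le, ← Real.sqrt_mul hN0.le]
      refine Real.sqrt_le_sqrt ?_
      calc _ ≤ ∑ _j : Fin N, ε k ^ 2 := by
            refine Finset.sum_le_sum fun j _ => ?_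
            have h := hii j
            rw [← sub_div, abs_div, abs_of_pos (hε0 k), div_le_one (hε0 k)] at h
            rw [Real.dist_eq]
            gcongr
        _ = _ := by simp
    · rw [← ENNReal.ofReal_mul (Finset.prod_nonneg fun j _ => by have := hε0 k; positivity)]
      refine ENNReal.ofReal_le_ofReal ?_
      rw [Finset.prod_const, Finset.card_univ, Fintype.card_fin]
      have h1 : 2 * (R / ε k) + 2 ≤ (2 * R + 2) / ε k := by
        rw [add_div, mul_div_assoc]
        have := (le_div_iff₀ (hε0 k)).2 (by linarith [hε1 k] : 2 * ε k ≤ 2)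
        linarith
      have h2 : ((1 / 2 : ℝ) ^ (d - N)) ^ k = ε k ^ d / ε k ^ N := by
        rw [← Real.rpow_natCast, ← Real.rpow_mul (by norm_num), mul_comm,
          Real.rpow_mul (by norm_num), Real.rpow_natCast, Real.rpow_sub (hε0 k),
          Real.rpow_natCast]
      calc _ ≤ ((2 * R + 2) / ε k) ^ N * ε k ^ d := by
            have := hε0 k
            gcongr
        _ = _ := by rw [h2, div_pow]; ring
  have hsum : ∑' k, μ (Bad k) ≠ ⊤ := by
    have hs : Summable fun k : ℕ => (2 * R + 2) ^ N * ((1 / 2 : ℝ) ^ (d - N)) ^ k :=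
      (summable_geometric_of_lt_one (by positivity)
        (Real.rpow_lt_one (by norm_num) (by norm_num) (by linarith))).mul_left _
    exact ne_top_of_le_ne_top hs.tsum_ofReal_ne_top (ENNReal.tsum_le_tsum hbad)
  refine ae_upperLocalDim_map_le μ hπ (b := 1 / 2 / D) (by positivity) hd0 ?_
  filter_upwards [ae_eventually_notMem hsum] with i hi
  refine eventually_rpow_le_of_seq (monotone_measure_closedBall _ (π i)) hε0 hεlim (by norm_num)
    (fun n => le_of_eq ?_) hD0 hd0 ?_
  · simp only [hε, pow_succ]; ring
  · filter_upwards [hi] with k hk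
    exact not_lt.1 fun hlt => hk ⟨mem_univ i, hlt⟩

/-! ### Geometry of the images of cylinders. -/

theorem Admissible.exists_norm_le {m N : ℕ} {T : Fin m → E N →L[ℝ] E N} (hT : ∀ i, ‖T i‖ < 1)
    {w : Translations m N} (hw : Admissible T w) :
    ∃ R : ℝ, 0 ≤ R ∧ ∀ (k : ℕ) (u : Fin (k + 1) → Fin m), ‖w (k + 1) u‖ ≤ R := by
  obtain ⟨B, ⟨x, hx⟩, hBc, hB⟩ := hw
  obtain ⟨R, hR⟩ := hBc.isBounded.exists_norm_le
  have hR0 : 0 ≤ R := (norm_nonneg x).trans (hR x hx)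
  refine ⟨R + R, by linarith, fun k u => ?_⟩
  have h1 := hR _ (hB k u x hx)
  have h2 : ‖T (u (Fin.last k)) x‖ ≤ R :=
    (((T _).le_opNorm x).trans (mul_le_of_le_one_left (norm_nonneg _) (hT _).le)).trans (hR x hx)
  calc ‖w (k + 1) u‖ = ‖(T (u (Fin.last k)) x + w (k + 1) u) - T (u (Fin.last k)) x‖ := by simp
    _ ≤ R + R := (norm_sub_le _ _).trans (add_le_add h1 h2)

theorem curtail_eq_of_le {m : ℕ} {i i' : Code m} {j k : ℕ} (h : curtail i k = curtail i' k)
    (hjk : j ≤ k) : curtail i j = curtail i' j := by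
  funext a
  exact congrFun h (Fin.castLE hjk a)

theorem wordMap_curtail_add {m N : ℕ} (T : Fin m → E N →L[ℝ] E N) (i : Code m) (j k : ℕ) :
    wordMap T (curtail i (j + k)) = wordMap T (curtail i k) * wordMap T (curtail (shift^[k] i) j) := by
  rw [add_comm, curtail_add, wordMap_append]

/-- Images of sequences in a common cylinder differ by the image of a bounded vector under the
linear map of the cylinder. -/
theorem exists_codeMap_sub_eq {m N : ℕ} {T : Fin m → E N →L[ℝ] E N} (hT : ∀ i, ‖T i‖ < 1)
    {w : Translations m N} (hw : Admissible T w) :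
    ∃ R : ℝ, 0 ≤ R ∧ ∀ k : ℕ, ∃ τ : Code m → E N, (∀ i, ‖τ i‖ ≤ R) ∧
      ∀ i i', curtail i k = curtail i' k →
        codeMap T w i - codeMap T w i' = wordMap T (curtail i k) (τ i - τ i') := by
  obtain ⟨R, hR0, hR⟩ := hw.exists_norm_le hT
  obtain ⟨ρ, hρ0, hρ1, hρ⟩ := exists_norm_le_lt_one hT
  have hs : Summable fun j : ℕ => ρ ^ j * R := (summable_geometric_of_lt_one hρ0.le hρ1).mul_right R
  refine ⟨∑' j : ℕ, ρ ^ j * R, tsum_nonneg fun j => by positivity, fun k => ?_⟩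
  -- The terms of the series from index `k` on, with the common factor `T_{i|k}` removed. The first
  -- `k` terms depend only on the cylinder and cancel in differences.
  set t : Code m → ℕ → E N := fun i j =>
    wordMap T (curtail (shift^[k] i) j) (w (j + k + 1) (curtail i (j + k + 1))) with ht
  have htb : ∀ i j, ‖t i j‖ ≤ ρ ^ j * R := fun i j =>
    ((wordMap T _).le_opNorm _).trans
      (mul_le_mul (norm_wordMap_le hρ0.le hρ j _) (hR _ _) (norm_nonneg _) (by positivity))
  have hts : ∀ i, Summable (t i) := fun i => hs.of_norm_bounded (htb i)
  refine ⟨fun i => ∑' j, t i j, fun i => tsum_of_norm_bounded hs.hasSum (htb i),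
    fun i i' hii => ?_⟩
  have hdec : ∀ i, codeMap T w i = ∑ j ∈ Finset.range k,
      wordMap T (curtail i j) (w (j + 1) (curtail i (j + 1))) +
        wordMap T (curtail i k) (∑' j, t i j) := by
    intro i
    rw [codeMap, ← (summable_codeMap T hT w hw i).sum_add_tsum_nat_add k,
      ContinuousLinearMap.map_tsum _ (hts i)]
    congr 1
    refine tsum_congr fun j => ?_
    rw [wordMap_curtail_add]
    rfl
  rw [hdec i, hdec i', map_sub, hii]
  have hsum : ∑ j ∈ Finset.range k, wordMap T (curtail i j) (w (j + 1) (curtail i (j + 1))) =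
      ∑ j ∈ Finset.range k, wordMap T (curtail i' j) (w (j + 1) (curtail i' (j + 1))) := by
    refine Finset.sum_congr rfl fun j hj => ?_
    have hj := Finset.mem_range.1 hj
    rw [curtail_eq_of_le hii hj.le, curtail_eq_of_le hii (Nat.succ_le_of_lt hj)]
  rw [hsum]
  abel

/-- This is the box count: the `n` axes with `α j ≥ a` contribute a multiple of `α j / a`, the
others only a constant. -/
theorem prod_ratio_le {N n : ℕ} (hn : n ≤ N) {α : ℕ → ℝ} {R a : ℝ} (ha : 0 < a) (hR : 0 ≤ R)
    (hα0 : ∀ j, 0 ≤ α j) (h1 : ∀ j < n, a ≤ α j) (h2 : ∀ j, n ≤ j → α j ≤ a) :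
    ∏ j : Fin N, (2 * (α j / a * R) + 2) ≤
      (2 * R + 2) ^ N * ((∏ j ∈ Finset.range n, α j) / a ^ n) := by
  have hb : ∀ j : ℕ, 2 * (α j / a * R) + 2 ≤ (2 * R + 2) * if j < n then α j / a else 1 := by
    intro j
    split_ifs with hj
    · have := (one_le_div ha).2 (h1 j hj)
      nlinarith
    · have h3 := (div_le_one ha).2 (h2 j (not_lt.1 hj))
      have h4 : α j / a * R ≤ R := mul_le_of_le_one_left hR h3
      linarith
  rw [Fin.prod_univ_eq_prod_range fun j => 2 * (α j / a * R) + 2]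
  calc _ ≤ ∏ j ∈ Finset.range N, ((2 * R + 2) * if j < n then α j / a else 1) :=
        Finset.prod_le_prod (fun j _ => by have := hα0 j; positivity) fun j _ => hb j
    _ = _ := by
        rw [Finset.prod_mul_distrib, Finset.prod_const, Finset.card_range, Finset.prod_ite,
          Finset.prod_const_one, mul_one, Finset.prod_div_distrib, Finset.prod_const]
        have : Finset.filter (fun j => j < n) (Finset.range N) = Finset.range n := by
          ext j; simp; omega
        rw [this, Finset.card_range]

theorem norm_sq_apply_eq_sum {N : ℕ} {A : E N →L[ℝ] E N} {e : OrthonormalBasis (Fin N) ℝ (E N)}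
    {α : ℕ → ℝ} (he : ∀ i j, inner ℝ (A (e i)) (A (e j)) = if i = j then α i ^ 2 else 0)
    (y : E N) : ‖A y‖ ^ 2 = ∑ j : Fin N, (α j * e.repr y j) ^ 2 := by
  have hy : A y = ∑ j, e.repr y j • A (e j) := by
    conv_lhs => rw [← e.sum_repr y]
    simp
  rw [← real_inner_self_eq_norm_sq, hy, sum_inner]
  refine Finset.sum_congr rfl fun j _ => ?_
  rw [inner_sum, Finset.sum_eq_single j]
  · rw [real_inner_smul_left, real_inner_smul_right, he, if_pos rfl]
    ring
  · intro i _ hij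
    rw [real_inner_smul_left, real_inner_smul_right, he, if_neg hij.symm]
    simp
  · simp

/-- Inside a cylinder, the set of sequences whose image has a ball of small mass, at the scale of
a singular value, has mass controlled by the singular value function. -/
theorem exists_measure_cyl_small_ball_le {m N : ℕ} (hN : 1 ≤ N) {T : Fin m → E N →L[ℝ] E N}
    (hT : ∀ i, ‖T i‖ < 1) (hTinj : ∀ i, Function.Injective (T i)) (μ : Measure (Code m))
    {w : Translations m N} (hw : Admissible T w) {d : ℝ} (hdN : d < N) :
    ∃ C : ℝ, 1 ≤ C ∧ ∀ (k : ℕ) (u : Fin k → Fin m),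
      μ {i ∈ cyl u | projMeasure T w μ (Metric.closedBall (codeMap T w i)
        (√N * (wordMap T u : E N →ₗ[ℝ] E N).singularValues ⌊d⌋₊)) <
          ENNReal.ofReal ((wordMap T u : E N →ₗ[ℝ] E N).singularValues ⌊d⌋₊ ^ d)} ≤
        ENNReal.ofReal (C * phi d (wordMap T u)) := by
  obtain ⟨R, hR0, hR⟩ := exists_codeMap_sub_eq hT hw
  refine ⟨(2 * R + 2) ^ N, one_le_pow₀ (by linarith), fun k u => ?_⟩
  obtain ⟨τ, hτR, hτ⟩ := hR k
  set A := wordMap T u with hA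
  have hn := floor_lt_of_lt hN hdN
  set n := ⌊d⌋₊ with hnd
  obtain ⟨e, he⟩ := exists_singular_basis A
  set α : ℕ → ℝ := fun j => (A : E N →ₗ[ℝ] E N).singularValues j with hα
  have hα0 : ∀ j, 0 ≤ α j := fun j => LinearMap.singularValues_nonneg _ j
  have hanti : Antitone α := LinearMap.singularValues_antitone _
  have ha : 0 < α n := singularValues_pos (wordMap_injective hTinj k u) hn
  -- The chart holds the coordinates of the image along the orthogonal directions `A e_j`, in units
  -- of `α n`. A unit cell is thus a cube of side `α n`, of diameter `√N * α n`.
  refine (measure_small_ball_le μ (continuous_codeMap T hT w hw).measurable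
    (g := fun i j => α j / α n * e.repr (τ i) j) (l := fun j => α j / α n * R)
    (fun i _ j => ?_) (fun i hi i' hi' hii => ?_) _).trans ?_
  · rw [abs_mul, abs_of_nonneg (div_nonneg (hα0 j) ha.le)]
    refine mul_le_mul_of_nonneg_left ?_ (div_nonneg (hα0 j) ha.le)
    have h := PiLp.norm_apply_le (e.repr (τ i)) j
    rw [e.repr.norm_map, Real.norm_eq_abs] at h
    exact h.trans (hτR i)
  · have hi1 : curtail i k = u := hi
    have hi2 : curtail i' k = u := hi'
    rw [dist_eq_norm, hτ i i' (hi1.trans hi2.symm), hi1]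
    refine le_of_sq_le_sq ?_ (mul_nonneg (Real.sqrt_nonneg _) ha.le)
    rw [norm_sq_apply_eq_sum (α := α) he, mul_pow, Real.sq_sqrt (Nat.cast_nonneg N)]
    calc _ ≤ ∑ _j : Fin N, α n ^ 2 := by
          refine Finset.sum_le_sum fun j _ => ?_
          have h := hii j
          rw [← mul_sub, div_mul_eq_mul_div, abs_div, abs_of_pos ha, div_le_one ha] at h
          rw [map_sub, ← sq_abs]
          gcongr
          exact h
      _ = _ := by simp [hα]
  · rw [← ENNReal.ofReal_mul (Finset.prod_nonneg fun j _ => by have := hα0 j; positivity)]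
    refine ENNReal.ofReal_le_ofReal ?_
    calc _ ≤ ((2 * R + 2) ^ N * (topProd A n / α n ^ n)) * α n ^ d :=
          mul_le_mul_of_nonneg_right (prod_ratio_le hn.le ha hR0 hα0
            (fun j hj => hanti hj.le) fun j hj => hanti hj) (by positivity)
      _ = _ := by
          rw [phi_of_lt hdN, Real.rpow_sub ha, Real.rpow_natCast]
          ring

/-- This turns the two bounds for the bad part of a cylinder into a summand of the pressure sum. -/
theorem min_le_rpow_mul_rpow {x y q : ℝ} (hx : 0 < x) (hy : 0 < y) (hq : q ∈ Ico (0 : ℝ) 1) :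
    min x y ≤ x ^ (1 - q) * y ^ q := by
  have hz : 0 < min x y := lt_min hx hy
  calc min x y = min x y ^ (1 - q) * min x y ^ q := by
        rw [← Real.rpow_add hz]; simp
    _ ≤ _ := mul_le_mul
        (Real.rpow_le_rpow hz.le (min_le_left _ _) (by linarith [hq.2]))
        (Real.rpow_le_rpow hz.le (min_le_right _ _) hq.1) (by positivity) (by positivity)

/-- If the sums that define the pressure at `(d, q)` are summable, then `d` is an upper bound for
the upper local dimension almost everywhere. -/
theorem ae_upperLocalDim_projMeasure_le {m N : ℕ} (hm : 2 ≤ m) (hN : 1 ≤ N)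
    {T : Fin m → E N →L[ℝ] E N} (hT : ∀ i, ‖T i‖ < 1) (hTinj : ∀ i, Function.Injective (T i))
    {μ : Measure (Code m)} (hμ : IsGibbs μ) {w : Translations m N} (hw : Admissible T w) {d q : ℝ}
    (hd0 : 0 ≤ d) (hdN : d < N) (hq : q ∈ Ico (0 : ℝ) 1) (hsum : Summable (wordSum T μ d q)) :
    ∀ᵐ x ∂(projMeasure T w μ), upperLocalDim (projMeasure T w μ) x ≤ d := by
  have hP : IsProbabilityMeasure μ := hμ.1
  have hm0 : 0 < m := by omega
  have hN0 : (0 : ℝ) < N := by exact_mod_cast hN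
  have hn := floor_lt_of_lt hN hdN
  obtain ⟨C, hC1, hC⟩ := exists_measure_cyl_small_ball_le hN hT hTinj μ hw hdN
  set n := ⌊d⌋₊
  set α : ∀ k, (Fin k → Fin m) → ℝ := fun k u =>
    (wordMap T u : E N →ₗ[ℝ] E N).singularValues n with hα
  set P : ∀ k, (Fin k → Fin m) → Code m → Prop := fun k u i =>
    projMeasure T w μ (Metric.closedBall (codeMap T w i) (√N * α k u)) <
      ENNReal.ofReal (α k u ^ d) with hPdef
  set Bad : ℕ → Set (Code m) := fun k => {i | P k (curtail i k) i} with hBad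
  have hword : ∀ k (u : Fin k → Fin m), μ {i ∈ cyl u | P k u i} ≤
      ENNReal.ofReal (C * (phi d (wordMap T u) ^ (1 - q) * μ.real (cyl u) ^ q)) := by
    intro k u
    have hφ := phi_pos hN d (wordMap_injective hTinj k u)
    have hμu := hμ.measure_cyl_pos hm0 u
    have h1 : μ {i ∈ cyl u | P k u i} ≤ ENNReal.ofReal (μ.real (cyl u)) := by
      rw [ofReal_measureReal]
      exact measure_mono fun i hi => hi.1
    have hCφ : 0 < C * phi d (wordMap T u) := mul_pos (by linarith) hφ
    have h2 : μ {i ∈ cyl u | P k u i} ≤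
        ENNReal.ofReal (min (C * phi d (wordMap T u)) (μ.real (cyl u))) := by
      rcases min_choice (C * phi d (wordMap T u)) (μ.real (cyl u)) with h | h
      · rw [h]; exact hC k u
      · rw [h]; exact h1
    refine h2.trans (ENNReal.ofReal_le_ofReal ((min_le_rpow_mul_rpow hCφ hμu hq).trans ?_))
    rw [Real.mul_rpow (by linarith) hφ.le, mul_assoc]
    refine mul_le_mul_of_nonneg_right ?_ (by positivity)
    simpa using Real.rpow_le_rpow_of_exponent_le hC1 (by linarith [hq.1] : 1 - q ≤ 1)
  have hbad : ∀ k, μ (Bad k) ≤ ENNReal.ofReal (C * wordSum T μ d q k) := by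
    intro k
    have hcover : Bad k ⊆ ⋃ u ∈ (Finset.univ : Finset (Fin k → Fin m)), {i ∈ cyl u | P k u i} := by
      intro i hi
      simp only [mem_iUnion]
      exact ⟨curtail i k, Finset.mem_univ _, rfl, hi⟩
    refine (measure_mono hcover).trans ((measure_biUnion_finset_le _ _).trans
      ((Finset.sum_le_sum fun u _ => hword k u).trans (le_of_eq ?_)))
    rw [← ENNReal.ofReal_sum_of_nonneg, wordSum, Finset.mul_sum]
    intro u _
    have hφ := phi_pos hN d (wordMap_injective hTinj k u)
    positivity
  have hfin : ∑' k, μ (Bad k) ≠ ⊤ :=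
    ne_top_of_le_ne_top (hsum.mul_left C).tsum_ofReal_ne_top (ENNReal.tsum_le_tsum hbad)
  obtain ⟨ρ, hρ0, hρ1, hρ⟩ := exists_norm_le_lt_one hT
  -- Appending a letter shrinks the radius by at most a fixed factor, uniformly over the finite
  -- alphabet.
  obtain ⟨κ, hκ0, hκ⟩ : ∃ κ : ℝ, 0 < κ ∧ ∀ j, ∀ A : E N →L[ℝ] E N, Function.Injective A →
      κ * (A : E N →ₗ[ℝ] E N).singularValues n ≤
        ((A * T j : E N →L[ℝ] E N) : E N →ₗ[ℝ] E N).singularValues n := by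
    choose κ hκ0 hκ using fun j => exists_mul_singularValues_le (hTinj j) hn
    have : Nonempty (Fin m) := ⟨⟨0, hm0⟩⟩
    obtain ⟨j₀, hj₀⟩ := Finite.exists_min κ
    exact ⟨κ j₀, hκ0 j₀, fun j A hA => (mul_le_mul_of_nonneg_right (hj₀ j)
      (LinearMap.singularValues_nonneg _ n)).trans (hκ j A hA)⟩
  refine ae_upperLocalDim_map_le μ (continuous_codeMap T hT w hw).measurable
    (b := κ / √N) (div_pos hκ0 (Real.sqrt_pos.2 hN0)) hd0 ?_
  filter_upwards [ae_eventually_notMem hfin] with i hi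
  refine eventually_rpow_le_of_seq (monotone_measure_closedBall _ (codeMap T w i))
    (ε := fun k => α k (curtail i k))
    (fun k => singularValues_pos (wordMap_injective hTinj k _) hn) ?_ hκ0 (fun k => ?_)
    (Real.sqrt_pos.2 hN0) hd0 ?_
  · exact squeeze_zero (fun k => LinearMap.singularValues_nonneg _ n)
      (fun k => (singularValues_le_norm _ n).trans (norm_wordMap_le hρ0.le hρ k _))
      (tendsto_pow_atTop_nhds_zero_of_lt_one hρ0.le hρ1)
  · simp only [hα]
    rw [curtail_add, wordMap_append, wordMap_single]
    exact hκ _ _ (wordMap_injective hTinj k _)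
  · filter_upwards [hi] with k hk
    exact not_lt.1 hk

end AlmostSelfAffine

/-! ### The main theorem. -/

theorem proposition7p1 {m N : ℕ} (hm : 2 ≤ m) (hN : 1 ≤ N)
    (T : Fin m → AlmostSelfAffine.E N →L[ℝ] AlmostSelfAffine.E N)
    (hT : ∀ i, ‖T i‖ < 1) (hTinj : ∀ i, Function.Injective (T i))
    (μ : Measure (AlmostSelfAffine.Code m)) (hμ : AlmostSelfAffine.IsGibbs μ) :
    -- the pressures and their zeros are well defined
    (∀ q ∈ Ico (0 : ℝ) 1, ∀ s : ℝ, 0 ≤ s →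
        Tendsto (AlmostSelfAffine.pressureSeq T μ s q) atTop
          (𝓝 (AlmostSelfAffine.pressure T μ s q))) ∧
      (∀ q ∈ Ico (0 : ℝ) 1, ∃! d : ℝ, 0 < d ∧ AlmostSelfAffine.pressure T μ d q = 0) ∧
      ∃ L : ℝ, Tendsto (AlmostSelfAffine.dimZero T μ) (𝓝[<] 1) (𝓝 L) ∧
        ∀ w : AlmostSelfAffine.Translations m N, AlmostSelfAffine.Admissible T w →
          ∀ᵐ x ∂(AlmostSelfAffine.projMeasure T w μ),
            AlmostSelfAffine.upperLocalDim (AlmostSelfAffine.projMeasure T w μ) x ≤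
              ((min L N : ℝ) : EReal) := by
  refine ⟨fun q hq s hs => AlmostSelfAffine.tendsto_pressureSeq hm hN hTinj hμ hs hq,
    fun q hq => AlmostSelfAffine.existsUnique_pressure_eq_zero hm hN hT hTinj hμ hq, ?_⟩
  obtain ⟨L, hL0, hL⟩ := AlmostSelfAffine.exists_tendsto_dimZero hm hN hT hTinj hμ
  refine ⟨L, hL, fun w hw => ?_⟩
  have hP : IsProbabilityMeasure μ := hμ.1
  have key : ∀ d : ℝ, min L N < d → ∀ᵐ x ∂(AlmostSelfAffine.projMeasure T w μ),
      AlmostSelfAffine.upperLocalDim (AlmostSelfAffine.projMeasure T w μ) x ≤ d := by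
    intro d hd
    rcases lt_or_ge (N : ℝ) d with hNd | hNd
    · obtain ⟨f, hf, hfb⟩ := AlmostSelfAffine.exists_bound T hT w hw
      exact AlmostSelfAffine.ae_upperLocalDim_map_le_of_dim_lt μ hN
        (AlmostSelfAffine.continuous_codeMap T hT w hw).measurable
        (fun i => tsum_of_norm_bounded hf.hasSum fun k => hfb k i) hNd
    · have hLN : L < min d N := by
        rcases min_lt_iff.1 hd with h | h
        · exact lt_min h (h.trans_le hNd)
        · exact absurd h (not_lt.2 hNd)
      -- Since `d = N` is possible here, a smaller `d'` secures the strict bound `d' < N` used by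
      -- the covering argument.
      obtain ⟨d', hd1, hd2⟩ := exists_between hLN
      have hd0 : 0 ≤ d' := hL0.trans hd1.le
      obtain ⟨q, hq, hsum⟩ :=
        AlmostSelfAffine.exists_summable_wordSum hm hN hT hTinj hμ hL hd0 hd1
      filter_upwards [AlmostSelfAffine.ae_upperLocalDim_projMeasure_le hm hN hT hTinj hμ hw hd0
        (hd2.trans_le (min_le_right _ _)) hq hsum] with x hx
      exact hx.trans (by exact_mod_cast (hd2.trans_le (min_le_left _ _)).le)
  -- Countably many exponents decreasing to `min L N` keep the exceptional set null.
  have hall : ∀ᵐ x ∂(AlmostSelfAffine.projMeasure T w μ), ∀ n : ℕ,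
      AlmostSelfAffine.upperLocalDim (AlmostSelfAffine.projMeasure T w μ) x ≤
        ((min L N + 1 / ((n : ℝ) + 1) : ℝ) : EReal) :=
    ae_all_iff.2 fun n => key _ (lt_add_of_pos_right _ (by positivity))
  filter_upwards [hall] with x hx
  have hlim : Tendsto (fun n : ℕ => ((min L N + 1 / ((n : ℝ) + 1) : ℝ) : EReal)) atTop
      (𝓝 ((min L N : ℝ) : EReal)) := by
    have h : Tendsto (fun n : ℕ => min L N + 1 / ((n : ℝ) + 1)) atTop (𝓝 (min L N)) := by
      simpa using tendsto_one_div_add_atTop_nhds_zero_nat.const_add (min L (N : ℝ))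
    exact continuous_coe_real_ereal.continuousAt.tendsto.comp h
  exact ge_of_tendsto' hlim hx
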